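/- A lazy reversible Markov chain on a finite tree \(T=(V,E)\) is a triple \((V,P,\pi)\), where \(P\) is a transition matrix on \(V\) with \(P(x,y)>0\) if and only if \(\{x,y\}\in E\) or \(x=y\), with \(P(x,x)\ge 1/2\) for all \(x\in V\), and \(\pi\) is its stationary distribution, satisfying \(\pi(x)P(x,y)=\pi(y)P(y,x)\) for all \(x,y\in V\). Let \[ d(t)=\max_{x\in V}\tfrac12\sum_{y\in V}|P^t(x,y)-\pi(y)|,\qquad t_{\mathrm{mix}}(\epsilon)=\min\{t\in\mathbb{Z}_{\ge 0}: d(t)\le\epsilon\},\qquad t_{\mathrm{mix}}=t_{\mathrm{mix}}(1/4), \] and, for \(|V|\ge 2\), let \(t_{\mathrm{rel}}=(1-\lambda_2)^{-1}\), where \(\lambda_2<1\) is the second largest eigenvalue of \(P\). (1) For every lazy reversible Markov chain on a finite tree with \(|V|\ge 3\) and every \(0<\epsilon\le 1/4\), \[ t_{\mathrm{mix}}(\epsilon)-t_{\mathrm{mix}}(1-\epsilon)\le 35\sqrt{\epsilon^{-1}\,t_{\mathrm{rel}}\,t_{\mathrm{mix}}}. \] (2) Let \((V_n,P_n,\pi_n)_{n\in\mathbb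 N}\) be a sequence of lazy reversible Markov chains on finite trees with \(|V_n|\ge 2\), and denote their parameters by a superscript \((n)\). The sequence exhibits a cutoff, that is, \[ \lim_{n\to\infty}\frac{t_{\mathrm{mix}}^{(n)}(\epsilon)}{t_{\mathrm{mix}}^{(n)}(1-\epsilon)}=1\quad\text{for every }0<\epsilon<1, \] if and only if the product condition \(t_{\mathrm{rel}}^{(n)}=o(t_{\mathrm{mix}}^{(n)})\) holds. Moreover, if the product condition holds, then \(w_n=\sqrt{t_{\mathrm{rel}}^{(n)}t_{\mathrm{mix}}^{(n)}}\) is a cutoff window: \(w_n=o(t_{\mathrm{mix}}^{(n)})\), and for every \(\epsilon\in(0,1)\) there is \(c_\epsilon>0\) such that \(t_{\mathrm{mix}}^{(n)}(\epsilon)-t_{\mathrm{mix}}^{(n)}(1-\epsilon)\le c_\epsilon w_n\) for all \(n\). (The quotient in the definition of cutoff is required to have a positive denominator for all large \(n\).) -/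

import Mathlib

open Filter Topology Asymptotics

universe u v

noncomputable section

/-- A Markov chain on a finite state space `V`: a transition matrix `P` together with a
stationary probability distribution `π`. -/
structure MarkovChain (V : Type*) [Fintype V] where
  P : Matrix V V ℝ
  π : V → ℝ
  P_nonneg : ∀ x y, 0 ≤ P x y
  P_sum : ∀ x, ∑ y, P x y = 1
  π_nonneg : ∀ x, 0 ≤ π x
  π_sum : ∑ x, π x = 1
  stationary : ∀ y, ∑ x, π x * P x y = π y

namespace MarkovChain

variable {V : Type*} [Fintype V]

/-- Detailed balance. -/
def IsReversible (C : MarkovChain V) : Prop :=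
  ∀ x y, C.π x * C.P x y = C.π y * C.P y x

/-- Holding probability at least `1/2` at every state. -/
def IsLazy (C : MarkovChain V) : Prop :=
  ∀ x, 1 / 2 ≤ C.P x x

/-- The chain is a (weighted, nearest-neighbour) chain on the graph `G`: the allowed
transitions are exactly the edges of `G`, in both directions, and staying put. -/
def IsOn (C : MarkovChain V) (G : SimpleGraph V) : Prop :=
  ∀ x y, 0 < C.P x y ↔ G.Adj x y ∨ x = y

/-- Total variation distance between two distributions on `V`. -/
def tv (μ ν : V → ℝ) : ℝ := (1 / 2) * ∑ x, |μ x - ν x|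

/-- `d(t)`: worst-case total variation distance from stationarity at time `t`; the row
`(P ^ t) x` is the law of `X_t` for the chain started at `x`. -/
def d [DecidableEq V] (C : MarkovChain V) (t : ℕ) : ℝ :=
  ⨆ x : V, tv ((C.P ^ t) x) C.π

/-- The `ε`-mixing time. -/
def tmix [DecidableEq V] (C : MarkovChain V) (ε : ℝ) : ℕ :=
  sInf {t : ℕ | C.d t ≤ ε}

/-- The second largest eigenvalue `λ₂`. The eigenvalue `1 = λ₁` of an irreducible chain is
simple and all its other real eigenvalues are smaller than `1`, so `λ₂` is the largest
eigenvalue different from `1` (it exists when a reversible irreducible chain has at least two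
states). -/
def lambda₂ [DecidableEq V] (C : MarkovChain V) : ℝ :=
  sSup {l : ℝ | l ≠ 1 ∧ Module.End.HasEigenvalue (Matrix.toLin' C.P) l}

/-- The relaxation time. -/
def trel [DecidableEq V] (C : MarkovChain V) : ℝ := (1 - C.lambda₂)⁻¹

end MarkovChain

section Sequences

variable {V : ℕ → Type*} [∀ n, Fintype (V n)] [∀ n, DecidableEq (V n)]

/-- Total variation cutoff of a sequence of chains. (A quotient with denominator `0` has the
value `0` here, so convergence to `1` forces the denominators to be eventually positive.) -/
def HasCutoff (C : ∀ n, MarkovChain (V n)) : Prop :=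
  ∀ ε : ℝ, 0 < ε → ε < 1 →
    Tendsto (fun n => ((C n).tmix ε : ℝ) / ((C n).tmix (1 - ε) : ℝ)) atTop (𝓝 1)

/-- `w` is a cutoff window for the sequence of chains. -/
def HasCutoffWindow (C : ∀ n, MarkovChain (V n)) (w : ℕ → ℝ) : Prop :=
  (w =o[atTop] fun n => ((C n).tmix (1 / 4) : ℝ)) ∧
  ∀ ε : ℝ, 0 < ε → ε < 1 → ∃ c : ℝ, 0 < c ∧
    ∀ n, ((C n).tmix ε : ℝ) - ((C n).tmix (1 - ε) : ℝ) ≤ c * w n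

/-- The product condition `t_rel = o(t_mix)`. -/
def ProductCondition (C : ∀ n, MarkovChain (V n)) : Prop :=
  (fun n => (C n).trel) =o[atTop] fun n => ((C n).tmix (1 / 4) : ℝ)

end Sequences

end

/-! Mixing on a tree is governed by hitting one central vertex `o`, chosen so that every branch at
`o` has stationary mass at most 1/2 (`exists_center`). A function vanishing at `o` splits over the
components of the tree without `o`. On each component the Poincaré inequality loses only a factor 2,
so the chain killed at `o` has spectral gap at least 1/(2 `trel`) (`ip_le_energy_of_center`). Hence
the stationary chain misses `o` for time `s` with probability at most exp(-s/(2 `trel`))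
(`sum_survival_le`).

Two consequences compare `d` with the hitting time of `o`. Once at `o`, the chain mixes in time of
order `trel`, because visits from stationarity control the return probability, which controls the
distance through Cauchy–Schwarz. Conversely, a chain that is partly mixed at time `t` has hit `o`
with noticeable probability soon afterwards.

The hitting time is concentrated: on a tree it is a sum of independent crossing times of the edges
towards `o`, and each crossing time has second moment at most 4 `trel` times its mean
(`HittingMoments.var_le` with `K = 2 * trel`). With `M` the largest mean hitting time of `o`,
Chebyshev puts all mixing times within order √(`trel` M / ε) + `trel` log(1/ε) of `M`
(`exists_mixing_center`), and `M` is at most of order `tmix` when `trel` is small compared with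
`tmix`. This gives the window bound `tmix_sub_le`, and so cutoff under the product condition. The
converse rests on the eigenvalue bound λ₂ᵗ ≤ 2 d(t). -/

noncomputable section

/-! ### Reversible chains: Dirichlet form, spectral decomposition, Poincaré inequality. -/

namespace MarkovChain

variable {V : Type*} [Fintype V]

/-- The inner product of `L²(π)`. -/
def ip (C : MarkovChain V) (f g : V → ℝ) : ℝ := ∑ x, C.π x * f x * g x

/-- The action of the transition matrix on functions. -/
def avg (C : MarkovChain V) (f : V → ℝ) (x : V) : ℝ := ∑ y, C.P x y * f y

/-- The Dirichlet form. -/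
def energy (C : MarkovChain V) (f : V → ℝ) : ℝ :=
  (1 / 2) * ∑ x, ∑ y, C.π x * C.P x y * (f x - f y) ^ 2

variable {C : MarkovChain V}

lemma ip_comm (f g : V → ℝ) : C.ip f g = C.ip g f := by
  simp only [ip]; exact Finset.sum_congr rfl fun x _ => by ring

lemma avg_le_of_le {f : V → ℝ} {c : ℝ} (h : ∀ x, f x ≤ c) (x : V) : C.avg f x ≤ c := by
  calc C.avg f x ≤ ∑ y, C.P x y * c :=
        Finset.sum_le_sum fun y _ => mul_le_mul_of_nonneg_left (h y) (C.P_nonneg x y)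
    _ = c := by rw [← Finset.sum_mul, C.P_sum, one_mul]

lemma le_avg_of_le {f : V → ℝ} {c : ℝ} (h : ∀ x, c ≤ f x) (x : V) : c ≤ C.avg f x := by
  calc c = ∑ y, C.P x y * c := by rw [← Finset.sum_mul, C.P_sum, one_mul]
    _ ≤ _ := Finset.sum_le_sum fun y _ => mul_le_mul_of_nonneg_left (h y) (C.P_nonneg x y)

lemma avg_mono {f g : V → ℝ} (h : ∀ x, f x ≤ g x) (x : V) : C.avg f x ≤ C.avg g x :=
  Finset.sum_le_sum fun y _ => mul_le_mul_of_nonneg_left (h y) (C.P_nonneg x y)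

lemma avg_const (c : ℝ) (x : V) : C.avg (fun _ => c) x = c := by
  rw [avg, ← Finset.sum_mul, C.P_sum, one_mul]

lemma avg_add (f g : V → ℝ) (x : V) : C.avg (fun y => f y + g y) x = C.avg f x + C.avg g x := by
  simp only [avg, mul_add, Finset.sum_add_distrib]

lemma avg_sub (f g : V → ℝ) (x : V) : C.avg (fun y => f y - g y) x = C.avg f x - C.avg g x := by
  simp only [avg, mul_sub, Finset.sum_sub_distrib]

lemma avg_const_mul (c : ℝ) (f : V → ℝ) (x : V) :
    C.avg (fun y => c * f y) x = c * C.avg f x := by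
  simp only [avg, Finset.mul_sum]; exact Finset.sum_congr rfl fun y _ => by ring

lemma ip_avg_symm (hrev : C.IsReversible) (f g : V → ℝ) :
    C.ip f (C.avg g) = C.ip (C.avg f) g := by
  simp only [ip, avg, Finset.mul_sum, Finset.sum_mul]
  rw [Finset.sum_comm]
  refine Finset.sum_congr rfl fun x _ => Finset.sum_congr rfl fun y _ => ?_
  linear_combination f y * g x * hrev y x

lemma sum_pi_avg (f : V → ℝ) : ∑ x, C.π x * C.avg f x = ∑ x, C.π x * f x := by
  simp only [avg, Finset.mul_sum]
  rw [Finset.sum_comm]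
  refine Finset.sum_congr rfl fun y _ => ?_
  rw [← C.stationary y, Finset.sum_mul]
  exact Finset.sum_congr rfl fun x _ => by ring

lemma sum_sum_left (f : V → ℝ) : ∑ x, ∑ y, C.π x * C.P x y * f x = ∑ x, C.π x * f x := by
  refine Finset.sum_congr rfl fun x _ => ?_
  rw [← Finset.sum_mul, ← Finset.mul_sum, C.P_sum, mul_one]

lemma sum_sum_right (f : V → ℝ) : ∑ x, ∑ y, C.π x * C.P x y * f y = ∑ x, C.π x * f x := by
  rw [Finset.sum_comm]
  refine Finset.sum_congr rfl fun x _ => ?_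
  rw [← Finset.sum_mul, C.stationary]

lemma sum_sum_cross (f : V → ℝ) :
    ∑ x, ∑ y, C.π x * C.P x y * (f x * f y) = C.ip f (C.avg f) := by
  simp only [ip, avg, Finset.mul_sum]
  exact Finset.sum_congr rfl fun x _ => Finset.sum_congr rfl fun y _ => by ring

lemma energy_eq (f : V → ℝ) : C.energy f = C.ip f f - C.ip f (C.avg f) := by
  have h1 := sum_sum_left (C := C) (fun x => f x ^ 2)
  have h2 := sum_sum_right (C := C) (fun x => f x ^ 2)
  have h3 := sum_sum_cross (C := C) f
  have h4 : C.ip f f = ∑ x, C.π x * f x ^ 2 := Finset.sum_congr rfl fun x _ => by ring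
  rw [h4, ← h3, energy]
  have : ∑ x, ∑ y, C.π x * C.P x y * (f x - f y) ^ 2 =
      ∑ x, ∑ y, C.π x * C.P x y * f x ^ 2 + ∑ x, ∑ y, C.π x * C.P x y * f y ^ 2
        - 2 * ∑ x, ∑ y, C.π x * C.P x y * (f x * f y) := by
    simp only [Finset.mul_sum, ← Finset.sum_add_distrib, ← Finset.sum_sub_distrib]
    exact Finset.sum_congr rfl fun x _ => Finset.sum_congr rfl fun y _ => by ring
  rw [this, h1, h2]; ring

lemma energy_nonneg (f : V → ℝ) : 0 ≤ C.energy f :=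
  mul_nonneg (by norm_num) (Finset.sum_nonneg fun x _ => Finset.sum_nonneg fun y _ =>
    mul_nonneg (mul_nonneg (C.π_nonneg x) (C.P_nonneg x y)) (sq_nonneg _))

/-- Expanding ∑ π(x) P(x,y) (f x + f y)² gives 2⟨f,f⟩ + 2⟨f,Pf⟩, and laziness makes the diagonal
terms alone at least 2⟨f,f⟩. -/
lemma ip_avg_nonneg (hlazy : C.IsLazy) (f : V → ℝ) : 0 ≤ C.ip f (C.avg f) := by
  classical
  have h1 := sum_sum_left (C := C) (fun x => f x ^ 2)
  have h2 := sum_sum_right (C := C) (fun x => f x ^ 2)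
  have h3 := sum_sum_cross (C := C) f
  have : ∑ x, ∑ y, C.π x * C.P x y * (f x + f y) ^ 2 =
      ∑ x, ∑ y, C.π x * C.P x y * f x ^ 2 + ∑ x, ∑ y, C.π x * C.P x y * f y ^ 2
        + 2 * ∑ x, ∑ y, C.π x * C.P x y * (f x * f y) := by
    simp only [Finset.mul_sum, ← Finset.sum_add_distrib]
    exact Finset.sum_congr rfl fun x _ => Finset.sum_congr rfl fun y _ => by ring
  have hd : 2 * ∑ x, C.π x * f x ^ 2 ≤ ∑ x, ∑ y, C.π x * C.P x y * (f x + f y) ^ 2 := by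
    rw [Finset.mul_sum]
    refine Finset.sum_le_sum fun x _ => ?_
    calc 2 * (C.π x * f x ^ 2) ≤ C.π x * C.P x x * (f x + f x) ^ 2 := by
          have := mul_le_mul_of_nonneg_left (hlazy x)
            (mul_nonneg (C.π_nonneg x) (sq_nonneg (f x)))
          nlinarith
      _ ≤ _ := Finset.single_le_sum (f := fun y => C.π x * C.P x y * (f x + f y) ^ 2)
          (fun y _ => mul_nonneg (mul_nonneg (C.π_nonneg x) (C.P_nonneg x y)) (sq_nonneg _))
          (Finset.mem_univ x)
  rw [this, h1, h2, h3] at hd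
  linarith

lemma IsOn.pi_pos {G : SimpleGraph V} (hon : C.IsOn G) (hG : G.Connected)
    (hrev : C.IsReversible) (x : V) : 0 < C.π x := by
  obtain ⟨z, hz⟩ : ∃ z, 0 < C.π z := by
    by_contra! h
    have := Finset.sum_nonpos (s := Finset.univ) fun x _ => h x
    rw [C.π_sum] at this; linarith
  obtain ⟨w⟩ := hG.preconnected x z
  induction w with
  | nil => exact hz
  | @cons a b c hab w ih =>
    have hb := ih hz
    have h1 := (hon a b).2 (Or.inl hab)
    have h2 := (hon b a).2 (Or.inl hab.symm)
    have h3 : 0 < C.π a * C.P a b := by rw [hrev a b]; exact mul_pos hb h2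
    exact (pos_iff_pos_of_mul_pos h3).2 h1

/-- A function of zero energy is constant. -/
lemma IsOn.eq_of_energy_eq_zero {G : SimpleGraph V} (hon : C.IsOn G) (hG : G.Connected)
    (hrev : C.IsReversible) {f : V → ℝ} (hf : C.energy f = 0) (x y : V) : f x = f y := by
  have hnn : ∀ x y, 0 ≤ C.π x * C.P x y * (f x - f y) ^ 2 := fun x y =>
    mul_nonneg (mul_nonneg (C.π_nonneg x) (C.P_nonneg x y)) (sq_nonneg _)
  have h0 : ∑ x, ∑ y, C.π x * C.P x y * (f x - f y) ^ 2 = 0 := by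
    rw [energy] at hf; linarith
  have h1 : ∀ x y, C.π x * C.P x y * (f x - f y) ^ 2 = 0 := fun x y => by
    have := (Finset.sum_eq_zero_iff_of_nonneg fun x _ =>
      Finset.sum_nonneg fun y _ => hnn x y).1 h0 x (Finset.mem_univ _)
    exact (Finset.sum_eq_zero_iff_of_nonneg fun y _ => hnn x y).1 this y (Finset.mem_univ _)
  have key : ∀ a b, G.Adj a b → f a = f b := fun a b hab => by
    have hp := mul_pos (hon.pi_pos hG hrev a) ((hon a b).2 (Or.inl hab))
    have := (mul_eq_zero.1 (h1 a b)).resolve_left hp.ne'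
    exact sub_eq_zero.1 (pow_eq_zero_iff (two_ne_zero)|>.1 this)
  obtain ⟨w⟩ := hG.preconnected x y
  induction w with
  | nil => rfl
  | cons h w ih => exact (key _ _ h).trans ih

lemma ip_self_pos (hpi : ∀ x, 0 < C.π x) {f : V → ℝ} (hf : f ≠ 0) : 0 < C.ip f f := by
  obtain ⟨x, hx⟩ := Function.ne_iff.1 hf
  refine Finset.sum_pos' (fun x _ => ?_) ⟨x, Finset.mem_univ _, ?_⟩
  · rw [mul_assoc]; exact mul_nonneg (C.π_nonneg x) (mul_self_nonneg _)
  · rw [mul_assoc]; exact mul_pos (hpi x) (mul_self_pos.2 hx)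

lemma ip_avg_of_eigen {f : V → ℝ} {l : ℝ} (hf : ∀ x, C.avg f x = l * f x) :
    C.ip f (C.avg f) = l * C.ip f f := by
  simp only [ip, hf, Finset.mul_sum]
  exact Finset.sum_congr rfl fun x _ => by ring

lemma ip_add (f g h : V → ℝ) : C.ip f (fun x => g x + h x) = C.ip f g + C.ip f h := by
  simp only [ip, mul_add, Finset.sum_add_distrib]

/-- Polarisation: Parseval for `f + Pf`, minus Parseval for `f` and for `Pf`, leaves the cross term.
-/
lemma ip_avg_eq_sum (hrev : C.IsReversible) {l : V → ℝ} {φ : V → V → ℝ}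
    (hφ : ∀ i x, C.avg (φ i) x = l i * φ i x)
    (hpars : ∀ f : V → ℝ, C.ip f f = ∑ i, C.ip (φ i) f ^ 2) (f : V → ℝ) :
    C.ip f (C.avg f) = ∑ i, l i * C.ip (φ i) f ^ 2 := by
  have h1 : ∀ i, C.ip (φ i) (C.avg f) = l i * C.ip (φ i) f := fun i => by
    rw [ip_avg_symm hrev]
    simp only [ip, hφ, Finset.mul_sum]
    exact Finset.sum_congr rfl fun x _ => by ring
  have h2 := hpars (fun x => f x + C.avg f x)
  rw [ip_add, ip_comm, ip_add, ip_comm (fun x => f x + C.avg f x), ip_add, hpars f,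
    hpars (C.avg f), ip_comm (C.avg f) f] at h2
  simp only [ip_add, h1, add_sq, Finset.sum_add_distrib] at h2
  have h3 : ∑ i, 2 * C.ip (φ i) f * (l i * C.ip (φ i) f) = 2 * ∑ i, l i * C.ip (φ i) f ^ 2 := by
    rw [Finset.mul_sum]; exact Finset.sum_congr rfl fun x _ => by ring
  rw [h3] at h2
  linarith

section Spectral

variable [DecidableEq V]

lemma hasEigenvalue_iff {l : ℝ} :
    Module.End.HasEigenvalue (Matrix.toLin' C.P) l ↔
      ∃ f : V → ℝ, f ≠ 0 ∧ ∀ x, C.avg f x = l * f x := by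
  constructor
  · intro h
    obtain ⟨f, hf⟩ := h.exists_hasEigenvector
    refine ⟨f, hf.2, fun x => ?_⟩
    have := congrFun hf.apply_eq_smul x
    simpa [Matrix.toLin'_apply, Matrix.mulVec, dotProduct, avg] using this
  · rintro ⟨f, hf0, hf⟩
    refine Module.End.hasEigenvalue_of_hasEigenvector (x := f) ⟨?_, hf0⟩
    rw [Module.End.mem_eigenspace_iff]
    funext x
    simpa [Matrix.toLin'_apply, Matrix.mulVec, dotProduct, avg] using hf x

lemma eigenvalue_le_one (hpi : ∀ x, 0 < C.π x) {l : ℝ}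
    (h : Module.End.HasEigenvalue (Matrix.toLin' C.P) l) : l ≤ 1 := by
  obtain ⟨f, hf0, hf⟩ := hasEigenvalue_iff.1 h
  have h1 := energy_nonneg (C := C) f
  rw [energy_eq, ip_avg_of_eigen hf] at h1
  have := ip_self_pos hpi hf0
  by_contra! hl
  nlinarith

lemma eigenvalue_nonneg (hlazy : C.IsLazy) (hpi : ∀ x, 0 < C.π x) {l : ℝ}
    (h : Module.End.HasEigenvalue (Matrix.toLin' C.P) l) : 0 ≤ l := by
  obtain ⟨f, hf0, hf⟩ := hasEigenvalue_iff.1 h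
  have h1 := ip_avg_nonneg hlazy f
  rw [ip_avg_of_eigen hf] at h1
  exact nonneg_of_mul_nonneg_left h1 (ip_self_pos hpi hf0)

lemma bddAbove_eigenvalues (hpi : ∀ x, 0 < C.π x) :
    BddAbove {l : ℝ | l ≠ 1 ∧ Module.End.HasEigenvalue (Matrix.toLin' C.P) l} :=
  ⟨1, fun _ hl => eigenvalue_le_one hpi hl.2⟩

/-- Spectral decomposition of a reversible chain in `L²(π)`. -/
lemma exists_eigenbasis (hrev : C.IsReversible) (hpi : ∀ x, 0 < C.π x) :
    ∃ (l : V → ℝ) (φ : V → V → ℝ), (∀ i x, C.avg (φ i) x = l i * φ i x) ∧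
      (∀ i, C.ip (φ i) (φ i) = 1) ∧
      (∀ f : V → ℝ, C.ip f f = ∑ i, C.ip (φ i) f ^ 2) := by
  set s : V → ℝ := fun x => Real.sqrt (C.π x) with hs
  have hs0 : ∀ x, 0 < s x := fun x => Real.sqrt_pos.2 (hpi x)
  have hss : ∀ x, s x * s x = C.π x := fun x => Real.mul_self_sqrt (hpi x).le
  -- Conjugating by √π turns detailed balance into symmetry, so the spectral theorem applies to `S`;
  -- its eigenvectors are divided by √π to return to `L²(π)`.
  set S : Matrix V V ℝ := Matrix.of fun x y => s x * C.P x y / s y with hSdef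
  have hS : S.IsHermitian := by
    ext x y
    simp only [hSdef, Matrix.conjTranspose_apply, Matrix.of_apply, star_trivial]
    rw [div_eq_div_iff (hs0 _).ne' (hs0 _).ne']
    have := hrev x y
    rw [← hss, ← hss] at this
    linear_combination -this
  set b := hS.eigenvectorBasis
  have hip : ∀ i (f : V → ℝ), C.ip (fun x => b i x / s x) f =
      inner ℝ (b i) (WithLp.toLp 2 fun x => s x * f x) := by
    intro i f
    rw [PiLp.inner_apply]
    refine Finset.sum_congr rfl fun x _ => ?_
    rw [← hss]
    have := (hs0 x).ne'
    simp only [RCLike.inner_apply, conj_trivial]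
    field_simp
  refine ⟨hS.eigenvalues, fun i x => b i x / s x, fun i x => ?_, fun i => ?_, fun f => ?_⟩
  · have h := congrFun (hS.mulVec_eigenvectorBasis i) x
    simp only [Matrix.mulVec, dotProduct, hSdef, Matrix.of_apply, Pi.smul_apply,
      smul_eq_mul] at h
    have h' : s x * C.avg (fun x => b i x / s x) x = hS.eigenvalues i * b i x := by
      rw [← h, avg, Finset.mul_sum]
      exact Finset.sum_congr rfl fun y _ => by ring
    rw [← mul_div_assoc, ← h', mul_div_cancel_left₀ _ (hs0 x).ne']
  · rw [hip]
    have : (WithLp.toLp 2 fun x => s x * (b i x / s x)) = b i := by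
      ext x
      exact mul_div_cancel₀ _ (hs0 x).ne'
    rw [this, real_inner_self_eq_norm_sq, b.orthonormal.1 i, one_pow]
  · simp_rw [hip]
    rw [b.sum_sq_inner_right, ← real_inner_self_eq_norm_sq, PiLp.inner_apply]
    refine Finset.sum_congr rfl fun x _ => ?_
    rw [← hss]
    simp only [RCLike.inner_apply, conj_trivial]
    ring

variable {G : SimpleGraph V}

/-- If every eigenvalue were 1, all energies would vanish, and the indicator of a point would be
constant. -/
lemma exists_eigenvalue_ne_one (hon : C.IsOn G) (hG : G.Connected) (hrev : C.IsReversible)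
    (hcard : 2 ≤ Fintype.card V) :
    ∃ l : ℝ, l ≠ 1 ∧ Module.End.HasEigenvalue (Matrix.toLin' C.P) l := by
  have hpi := hon.pi_pos hG hrev
  obtain ⟨l, φ, hφ, h1, hpars⟩ := exists_eigenbasis hrev hpi
  by_contra! h
  have hl : ∀ i, l i = 1 := fun i => by
    by_contra hi
    refine h _ hi (hasEigenvalue_iff.2 ⟨φ i, fun h0 => ?_, hφ i⟩)
    have := h1 i
    rw [h0] at this
    simp [ip] at this
  obtain ⟨a, b, hab⟩ := Fintype.exists_pair_of_one_lt_card (by omega : 1 < Fintype.card V)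
  have : C.energy (fun x => if x = a then 1 else 0) = 0 := by
    rw [energy_eq, ip_avg_eq_sum hrev hφ hpars, hpars]
    simp [hl]
  have := hon.eq_of_energy_eq_zero hG hrev this a b
  simp [hab.symm] at this

lemma lambda₂_mem (hon : C.IsOn G) (hG : G.Connected) (hrev : C.IsReversible)
    (hcard : 2 ≤ Fintype.card V) :
    C.lambda₂ ≠ 1 ∧ Module.End.HasEigenvalue (Matrix.toLin' C.P) C.lambda₂ := by
  have hfin : {l : ℝ | l ≠ 1 ∧ Module.End.HasEigenvalue (Matrix.toLin' C.P) l}.Finite :=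
    (Module.End.finite_hasEigenvalue (Matrix.toLin' C.P)).subset fun l hl => hl.2
  exact Set.Nonempty.csSup_mem (exists_eigenvalue_ne_one hon hG hrev hcard) hfin

lemma lambda₂_lt_one (hon : C.IsOn G) (hG : G.Connected) (hrev : C.IsReversible)
    (hcard : 2 ≤ Fintype.card V) : C.lambda₂ < 1 :=
  have h := lambda₂_mem hon hG hrev hcard
  lt_of_le_of_ne (eigenvalue_le_one (hon.pi_pos hG hrev) h.2) h.1

lemma lambda₂_nonneg (hon : C.IsOn G) (hG : G.Connected) (hlazy : C.IsLazy)
    (hrev : C.IsReversible) (hcard : 2 ≤ Fintype.card V) : 0 ≤ C.lambda₂ :=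
  eigenvalue_nonneg hlazy (hon.pi_pos hG hrev) (lambda₂_mem hon hG hrev hcard).2

lemma one_le_trel (hon : C.IsOn G) (hG : G.Connected) (hlazy : C.IsLazy)
    (hrev : C.IsReversible) (hcard : 2 ≤ Fintype.card V) : 1 ≤ C.trel := by
  have h0 := lambda₂_nonneg hon hG hlazy hrev hcard
  have h1 := lambda₂_lt_one hon hG hrev hcard
  exact (one_le_inv₀ (by linarith)).2 (by linarith)

/-- The Poincaré inequality. -/
lemma poincare (hon : C.IsOn G) (hG : G.Connected) (hrev : C.IsReversible)
    (hcard : 2 ≤ Fintype.card V) (f : V → ℝ) :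
    C.ip f f - (∑ x, C.π x * f x) ^ 2 ≤ C.trel * C.energy f := by
  have hpi := hon.pi_pos hG hrev
  obtain ⟨l, φ, hφ, h1, hpars⟩ := exists_eigenbasis hrev hpi
  set m := ∑ x, C.π x * f x with hm
  set g : V → ℝ := fun x => f x - m with hg
  have hgm : ∑ x, C.π x * g x = 0 := by
    simp only [hg, mul_sub, Finset.sum_sub_distrib, ← Finset.sum_mul, C.π_sum, ← hm]; ring
  have hgg : C.ip g g = C.ip f f - m ^ 2 := by
    have : ∀ x, C.π x * g x * g x = C.π x * f x * f x - 2 * m * (C.π x * f x) + C.π x * m ^ 2 :=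
      fun x => by simp only [hg]; ring
    simp only [ip, this, Finset.sum_add_distrib, Finset.sum_sub_distrib, ← Finset.mul_sum,
      ← Finset.sum_mul, C.π_sum, ← hm]
    ring
  have hge : C.energy g = C.energy f := by simp [energy, hg]
  have hlt := lambda₂_lt_one hon hG hrev hcard
  have key : (1 - C.lambda₂) * C.ip g g ≤ C.energy g := by
    rw [energy_eq, ip_avg_eq_sum hrev hφ hpars, hpars, Finset.mul_sum,
      ← Finset.sum_sub_distrib]
    refine Finset.sum_le_sum fun i _ => ?_
    -- An eigenfunction for the eigenvalue 1 has zero energy, hence is constant and orthogonal to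
    -- the centred function `g`. The other eigenvalues are at most `lambda₂`.
    by_cases hi : l i = 1
    · have hc : C.energy (φ i) = 0 := by
        rw [energy_eq, ip_avg_of_eigen (hφ i), hi]; ring
      have hcc := hon.eq_of_energy_eq_zero hG hrev hc
      have : C.ip (φ i) g = 0 := by
        have : ∀ x, C.π x * φ i x * g x = φ i i * (C.π x * g x) := fun x => by
          rw [hcc x i]; ring
        simp only [ip, this, ← Finset.mul_sum, hgm, mul_zero]
      simp [this]
    · have hle : l i ≤ C.lambda₂ := by
        refine le_csSup (bddAbove_eigenvalues hpi) ⟨hi, hasEigenvalue_iff.2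
          ⟨φ i, fun h0 => ?_, hφ i⟩⟩
        have := h1 i
        rw [h0] at this
        simp [ip] at this
      nlinarith [sq_nonneg (C.ip (φ i) g)]
  rw [hgg, hge] at key
  rw [trel, ← div_eq_inv_mul, le_div_iff₀ (by linarith)]
  linarith

end Spectral

end MarkovChain

/-! ### Branches of a tree. -/

namespace SimpleGraph

variable {V : Type*} {G : SimpleGraph V}

lemma Connected.exists_adj_dist_add_one (hG : G.Connected) {y x : V} (h : y ≠ x) :
    ∃ z, G.Adj y z ∧ G.dist z x + 1 = G.dist y x := by
  obtain ⟨w, hw⟩ := hG.exists_walk_length_eq_dist y x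
  cases w with
  | nil => exact absurd rfl h
  | @cons _ z _ hz w =>
    refine ⟨z, hz, le_antisymm ?_ ?_⟩
    · rw [← hw, Walk.length_cons]; exact Nat.succ_le_succ (dist_le w)
    · have := hG.dist_triangle (u := y) (v := z) (w := x)
      rw [dist_eq_one_iff_adj.2 hz] at this
      omega

/-- The vertices strictly closer to `x` than to `p`; for an edge `xp` of a tree this is the
side of `x`. -/
def branch (G : SimpleGraph V) (x p : V) : Set V := {y | G.dist y x < G.dist y p}

lemma Adj.mem_branch {x p : V} (h : G.Adj x p) : x ∈ G.branch x p := by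
  simp [branch, dist_eq_one_iff_adj.2 h]

lemma notMem_branch_self {x p : V} : p ∉ G.branch x p := by
  simp [branch]

/-- The only edge leaving a branch of a tree is the one which defines it. -/
lemma IsTree.eq_of_adj_branch (hT : G.IsTree) {x p y z : V} (hxp : G.Adj x p)
    (hyz : G.Adj y z) (hy : y ∈ G.branch x p) (hz : z ∉ G.branch x p) : y = x ∧ z = p := by
  have hC := hT.connected
  -- Without the edge `xp`, geodesics still join each vertex of the branch to `x` and every other
  -- vertex to `p`. A second edge leaving the branch would then reconnect `x` with `p`, although
  -- every edge of a tree is a bridge.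
  set H := G.deleteEdges {s(x, p)} with hH
  have hne : ∀ {a b : V}, G.Adj a b → s(a, b) ≠ s(x, p) → H.Adj a b := fun hab h =>
    deleteEdges_adj.2 ⟨hab, h⟩
  have h1 : ∀ n y, G.dist y x = n → y ∈ G.branch x p → H.Reachable y x := by
    intro n
    induction n with
    | zero =>
      intro y hn _
      rw [hC.dist_eq_zero_iff.1 hn]
    | succ n ih =>
      intro y hn hy
      have hyx : y ≠ x := by rintro rfl; simp at hn
      obtain ⟨z, hyz, hz⟩ := hC.exists_adj_dist_add_one hyx
      have htri := hC.dist_triangle (u := y) (v := z) (w := p)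
      rw [dist_eq_one_iff_adj.2 hyz] at htri
      have hzb : z ∈ G.branch x p := by
        simp only [branch, Set.mem_ofPred_eq] at hy ⊢; omega
      refine (hne hyz fun he => ?_).reachable.trans (ih z (by omega) hzb)
      rcases Sym2.eq_iff.1 he with h | h
      · exact hyx h.1
      · exact notMem_branch_self (h.1 ▸ hy)
  have h2 : ∀ n y, G.dist y p = n → y ∉ G.branch x p → H.Reachable y p := by
    intro n
    induction n with
    | zero =>
      intro y hn _
      rw [hC.dist_eq_zero_iff.1 hn]
    | succ n ih =>
      intro y hn hy
      have hyp : y ≠ p := by rintro rfl; simp at hn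
      obtain ⟨z, hyz, hz⟩ := hC.exists_adj_dist_add_one hyp
      have htri := hC.dist_triangle (u := y) (v := z) (w := x)
      rw [dist_eq_one_iff_adj.2 hyz] at htri
      have hzb : z ∉ G.branch x p := by
        simp only [branch, Set.mem_ofPred_eq] at hy ⊢; omega
      refine (hne hyz fun he => ?_).reachable.trans (ih z (by omega) hzb)
      rcases Sym2.eq_iff.1 he with h | h
      · exact hy (h.1 ▸ hxp.mem_branch)
      · exact hyp h.1
  by_cases he : s(y, z) = s(x, p)
  · rcases Sym2.eq_iff.1 he with h | h
    · exact h
    · exact absurd (h.1 ▸ hy) notMem_branch_self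
  · exact absurd ((h1 _ y rfl hy).symm.trans ((hne hyz he).reachable.trans (h2 _ z rfl hz)))
      (isAcyclic_iff_forall_adj_isBridge.1 hT.isAcyclic hxp)

end SimpleGraph

/-! ### The central vertex and the Poincaré inequality for functions vanishing there. -/

namespace MarkovChain

variable {V : Type*} [Fintype V] {C : MarkovChain V} {G : SimpleGraph V}

open Classical in
/-- There is a vertex all of whose branches have mass at most `1 / 2`. -/
lemma exists_center (C : MarkovChain V) (hG : G.Connected) :
    ∃ o, ∀ x, G.Adj x o → ∑ y with y ∈ G.branch x o, C.π y ≤ 1 / 2 := by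
  have hne : Nonempty V := hG.nonempty
  -- `o` minimises the `π`-mean distance. Moving to a neighbour `x` gains 1 on its branch and loses
  -- at most 1 elsewhere, so the branch cannot carry more than half of the mass.
  obtain ⟨o, ho⟩ := Finite.exists_min fun x => ∑ y, C.π y * (G.dist y x : ℝ)
  refine ⟨o, fun x hx => ?_⟩
  have h : ∑ y, C.π y * (G.dist y x : ℝ) ≤
      ∑ y, (C.π y * (G.dist y o : ℝ) + C.π y - 2 * if y ∈ G.branch x o then C.π y else 0) := by
    refine Finset.sum_le_sum fun y _ => ?_
    split_ifs with hy
    · have h1 : G.dist y x + 1 ≤ G.dist y o := hy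
      have h2 : (G.dist y x : ℝ) + 1 ≤ G.dist y o := by exact_mod_cast h1
      nlinarith [C.π_nonneg y]
    · have h1 := hG.dist_triangle (u := y) (v := o) (w := x)
      rw [SimpleGraph.dist_eq_one_iff_adj.2 hx.symm] at h1
      have h2 : (G.dist y x : ℝ) ≤ G.dist y o + 1 := by exact_mod_cast h1
      nlinarith [C.π_nonneg y]
  rw [Finset.sum_sub_distrib, Finset.sum_add_distrib, C.π_sum, ← Finset.mul_sum,
    ← Finset.sum_filter] at h
  linarith [ho x]

open Classical in
/-- Poincaré inequality for functions vanishing at a vertex whose branches have mass at most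
`1 / 2`. -/
lemma ip_le_energy_of_center [DecidableEq V] (hT : G.IsTree) (hon : C.IsOn G)
    (hrev : C.IsReversible) (hlazy : C.IsLazy)
    (hcard : 2 ≤ Fintype.card V) {o : V}
    (ho : ∀ x, G.Adj x o → ∑ y with y ∈ G.branch x o, C.π y ≤ 1 / 2)
    (f : V → ℝ) (hf : f o = 0) : C.ip f f ≤ 2 * C.trel * C.energy f := by
  have hC := hT.connected
  have hR := one_le_trel hon hC hlazy hrev hcard
  set H := G.deleteIncidenceSet o with hH
  set c : V → H.ConnectedComponent := H.connectedComponentMk with hc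
  have hadj : ∀ {a b}, G.Adj a b → c a ≠ c b → a = o ∨ b = o := by
    intro a b hab hne
    by_contra! h
    exact hne (SimpleGraph.ConnectedComponent.sound
      (SimpleGraph.deleteIncidenceSet_adj.2 ⟨hab, h.1, h.2⟩ : H.Adj a b).reachable)
  have hmass : ∀ k, ∑ y with y ≠ o ∧ c y = k, C.π y ≤ 1 / 2 := by
    intro k
    by_cases hk : ∃ y, y ≠ o ∧ c y = k
    swap
    · push Not at hk
      rw [Finset.filter_false_of_mem fun y _ h => hk y h.1 h.2]
      norm_num
    obtain ⟨y, hyo, hyk⟩ := hk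
    obtain ⟨x, hxo, hyx⟩ : ∃ x, G.Adj x o ∧ y ∈ G.branch x o := by
      obtain ⟨w, hw⟩ := hC.exists_walk_length_eq_dist o y
      cases w with
      | nil => exact absurd rfl hyo
      | @cons _ z _ hz w =>
        refine ⟨z, hz.symm, ?_⟩
        have := SimpleGraph.dist_le w
        rw [SimpleGraph.Walk.length_cons] at hw
        simp only [SimpleGraph.branch, Set.mem_ofPred_eq]
        rw [SimpleGraph.dist_comm, SimpleGraph.dist_comm (u := y)]
        omega
    have hsub : ∀ a b, H.Reachable a b → a ∈ G.branch x o → b ∈ G.branch x o := by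
      rintro a b ⟨w⟩
      induction w with
      | nil => exact id
      | @cons a b _ hab w ih =>
        intro ha
        refine ih ?_
        by_contra hb
        have h1 := SimpleGraph.deleteIncidenceSet_adj.1 hab
        exact h1.2.2 (hT.eq_of_adj_branch hxo h1.1 ha hb).2
    refine le_trans (Finset.sum_le_sum_of_subset_of_nonneg ?_ fun _ _ _ => C.π_nonneg _) (ho x hxo)
    intro z hz
    simp only [Finset.mem_filter, Finset.mem_univ, true_and] at hz ⊢
    exact hsub y z (SimpleGraph.ConnectedComponent.exact (hyk.trans hz.2.symm)) hyx
  -- The pieces of `f` on the components left after `o` is isolated; each lives inside one branch at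
  -- `o`.
  set F : H.ConnectedComponent → V → ℝ := fun k y => if c y = k then f y else 0 with hF
  have hsum : ∀ y, ∑ k, F k y ^ 2 = f y ^ 2 := fun y => by
    simp [hF, ite_pow]
  have hip : ∑ k, C.ip (F k) (F k) = C.ip f f := by
    simp only [ip]
    rw [Finset.sum_comm]
    refine Finset.sum_congr rfl fun y _ => ?_
    have := hsum y
    simp only [mul_assoc, ← Finset.mul_sum, ← sq, this]
  -- Edges between different components touch `o`, where `f` vanishes, so the energy has no cross
  -- terms.
  have hen : ∑ k, C.energy (F k) = C.energy f := by
    simp only [energy, ← Finset.mul_sum]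
    congr 1
    rw [Finset.sum_comm]
    refine Finset.sum_congr rfl fun y _ => ?_
    rw [Finset.sum_comm]
    refine Finset.sum_congr rfl fun z _ => ?_
    rw [← Finset.mul_sum]
    rcases (C.P_nonneg y z).eq_or_lt with h0 | h0
    · simp [← h0]
    congr 1
    by_cases hyz : c y = c z
    · have : ∀ k, (F k y - F k z) ^ 2 = if c z = k then (f y - f z) ^ 2 else 0 := fun k => by
        simp only [hF, hyz]; split_ifs <;> simp
      simp [this]
    · have hyz' : G.Adj y z := ((hon y z).1 h0).resolve_right fun h => hyz (h ▸ rfl)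
      have hprod : ∀ k, F k y * F k z = 0 := fun k => by
        rcases hadj hyz' hyz with h | h <;> simp [hF, h, hf]
      have hfp : f y * f z = 0 := by
        rcases hadj hyz' hyz with h | h <;> simp [h, hf]
      have : ∀ k, (F k y - F k z) ^ 2 = F k y ^ 2 + F k z ^ 2 := fun k => by
        linear_combination -2 * hprod k
      simp only [this, Finset.sum_add_distrib, hsum]
      linear_combination 2 * hfp
  have hk : ∀ k, C.ip (F k) (F k) ≤ 2 * C.trel * C.energy (F k) := by
    intro k
    have hpo := poincare hon hC hrev hcard (F k)
    -- The support has mass at most 1/2, so by Cauchy–Schwarz the squared mean is at most half of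
    -- the second moment. The variance is thus at least the other half, whence the factor 2.
    have hcs : (∑ x, C.π x * F k x) ^ 2 ≤ (1 / 2) * C.ip (F k) (F k) := by
      have h1 : ∑ x, C.π x * F k x = ∑ x with x ≠ o ∧ c x = k, C.π x * F k x := by
        rw [Finset.sum_filter]
        refine Finset.sum_congr rfl fun x _ => ?_
        split_ifs with h
        · rfl
        · by_cases hx : x = o
          · simp [hF, hx, hf]
          · have : c x ≠ k := fun h' => h ⟨hx, h'⟩
            simp [hF, this]
      rw [h1]
      have h2 := Finset.sum_sq_le_sum_mul_sum_of_sq_le_mul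
        (Finset.univ.filter fun x => x ≠ o ∧ c x = k)
        (r := fun x => C.π x * F k x) (f := C.π) (g := fun x => C.π x * F k x * F k x)
        (fun x _ => C.π_nonneg x)
        (fun x _ => by rw [mul_assoc]; exact mul_nonneg (C.π_nonneg x) (mul_self_nonneg _))
        (fun x _ => le_of_eq (by ring))
      refine h2.trans (mul_le_mul (hmass k) ?_ ?_ (by norm_num))
      · exact Finset.sum_le_sum_of_subset_of_nonneg (Finset.subset_univ _) fun x _ _ => by
          rw [mul_assoc]; exact mul_nonneg (C.π_nonneg x) (mul_self_nonneg _)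
      · exact Finset.sum_nonneg fun x _ => by
          rw [mul_assoc]; exact mul_nonneg (C.π_nonneg x) (mul_self_nonneg _)
    linarith
  rw [← hip, ← hen, Finset.mul_sum]
  exact Finset.sum_le_sum fun k _ => hk k

end MarkovChain

/-! ### Geometric decay, powers of the transition matrix, return probabilities. -/

namespace MarkovChain

variable {V : Type*} [Fintype V] {C : MarkovChain V}

/-- If `c (s + r) = ⟨k s, k r⟩` where `k` follows the chain along inner products, then a bound
on the quadratic form of `P` along `k` gives geometric decay of `c`. -/
lemma decay_of_quadratic_bound (hlazy : C.IsLazy) {k : ℕ → V → ℝ}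
    {c : ℕ → ℝ} {l : ℝ} (hl : 0 < l) (h1 : ∀ s r, C.ip (k s) (k r) = c (s + r))
    (h2 : ∀ s r, C.ip (k s) (C.avg (k r)) = c (s + r + 1))
    (h3 : ∀ s, C.ip (k s) (C.avg (k s)) ≤ l * C.ip (k s) (k s)) (t : ℕ) :
    c (t + 1) ≤ l * c t := by
  have heven : ∀ s, c (s + s + 1) ≤ l * c (s + s) := fun s => by
    rw [← h2, ← h1]; exact h3 s
  rcases Nat.even_or_odd' t with ⟨s, rfl | rfl⟩
  · rw [two_mul]; exact heven s
  -- Odd times: positivity of `P` at k(s+1) - l k(s) reads 0 ≤ c(2s+3) - 2l c(2s+2) + l² c(2s+1),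
  -- and the even case bounds c(2s+3) by l c(2s+2).
  · have h := ip_avg_nonneg hlazy (C := C) (fun x => k (s + 1) x - l * k s x)
    have e : C.ip (fun x => k (s + 1) x - l * k s x)
        (C.avg fun x => k (s + 1) x - l * k s x) =
        C.ip (k (s + 1)) (C.avg (k (s + 1))) - l * C.ip (k s) (C.avg (k (s + 1)))
          - l * C.ip (k (s + 1)) (C.avg (k s)) + l ^ 2 * C.ip (k s) (C.avg (k s)) := by
      simp only [ip, avg_sub, avg_const_mul, Finset.mul_sum, ← Finset.sum_sub_distrib,
        ← Finset.sum_add_distrib]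
      exact Finset.sum_congr rfl fun x _ => by ring
    rw [e, h2, h2, h2, h2] at h
    have h4 := heven (s + 1)
    have e1 : s + 1 + (s + 1) = 2 * s + 2 := by ring
    have e2 : s + (s + 1) + 1 = 2 * s + 2 := by ring
    have e3 : s + 1 + s + 1 = 2 * s + 2 := by ring
    have e4 : s + s + 1 = 2 * s + 1 := by ring
    rw [e1] at h h4
    rw [e2, e3, e4] at h
    have h5 : l * c (2 * s + 2) ≤ l * (l * c (2 * s + 1)) := by nlinarith
    exact le_of_mul_le_mul_left h5 hl

section Powers

variable [DecidableEq V]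

lemma pow_succ_apply (t : ℕ) (x z : V) :
    (C.P ^ (t + 1)) x z = C.avg (fun y => (C.P ^ t) y z) x := by
  rw [pow_succ', Matrix.mul_apply]; rfl

lemma pow_succ_apply' (t : ℕ) (x z : V) :
    (C.P ^ (t + 1)) x z = ∑ y, (C.P ^ t) x y * C.P y z := by
  rw [pow_succ, Matrix.mul_apply]

lemma pow_nonneg' (t : ℕ) (x y : V) : 0 ≤ (C.P ^ t) x y := by
  induction t generalizing x with
  | zero => rw [pow_zero, Matrix.one_apply]; split_ifs <;> norm_num
  | succ t ih => rw [pow_succ_apply]; exact le_avg_of_le (fun y => ih y) x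

lemma pow_sum (t : ℕ) (x : V) : ∑ y, (C.P ^ t) x y = 1 := by
  induction t generalizing x with
  | zero => simp [Matrix.one_apply]
  | succ t ih =>
    simp only [pow_succ_apply, avg]
    rw [Finset.sum_comm]
    simp only [← Finset.mul_sum, ih, mul_one, C.P_sum]

lemma pow_reversible (hrev : C.IsReversible) (t : ℕ) (x y : V) :
    C.π x * (C.P ^ t) x y = C.π y * (C.P ^ t) y x := by
  induction t generalizing x y with
  | zero =>
    simp only [pow_zero, Matrix.one_apply, eq_comm (a := y)]
    split_ifs with h
    · rw [h]
    · simp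
  | succ t ih =>
    rw [pow_succ_apply, pow_succ_apply', avg, Finset.mul_sum, Finset.mul_sum]
    refine Finset.sum_congr rfl fun z _ => ?_
    have h1 := hrev x z
    have h2 := ih z y
    linear_combination (C.P ^ t) z y * h1 + C.P z x * h2

/-- In a lazy reversible chain the return probabilities decrease. -/
lemma return_antitone (hrev : C.IsReversible) (hlazy : C.IsLazy) {o : V} (ho : 0 < C.π o) :
    Antitone fun t => (C.P ^ t) o o := by
  refine antitone_nat_of_succ_le fun t => ?_
  have hk : ∀ s r, C.ip (fun x => (C.P ^ s) x o) (fun x => (C.P ^ r) x o) =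
      C.π o * (C.P ^ (s + r)) o o := fun s r => by
    rw [pow_add, Matrix.mul_apply, ip, Finset.mul_sum]
    refine Finset.sum_congr rfl fun x _ => ?_
    rw [pow_reversible hrev, mul_assoc]
  have havg : ∀ r, C.avg (fun x => (C.P ^ r) x o) = fun x => (C.P ^ (r + 1)) x o := fun r => by
    funext x; rw [pow_succ_apply]
  have := decay_of_quadratic_bound hlazy (k := fun s x => (C.P ^ s) x o)
    (c := fun t => C.π o * (C.P ^ t) o o) one_pos hk
    (fun s r => by rw [havg, hk, add_assoc])
    (fun s => by
      rw [one_mul]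
      have := energy_nonneg (C := C) (fun x => (C.P ^ s) x o)
      rw [energy_eq] at this
      linarith) t
  simp only [one_mul] at this
  exact le_of_mul_le_mul_left this ho

end Powers

lemma tv_nonneg (μ ν : V → ℝ) : 0 ≤ tv μ ν :=
  mul_nonneg (by norm_num) (Finset.sum_nonneg fun _ _ => abs_nonneg _)

lemma nonempty_states (C : MarkovChain V) : Nonempty V := by
  by_contra h
  rw [not_nonempty_iff] at h
  simpa using C.π_sum

/-! ### Distance to stationarity. -/

section Distance

variable [DecidableEq V]

lemma tv_le_d (t : ℕ) (x : V) : tv ((C.P ^ t) x) C.π ≤ C.d t :=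
  le_ciSup (f := fun x => tv ((C.P ^ t) x) C.π) (Set.finite_range _).bddAbove x

lemma d_le {t : ℕ} {b : ℝ} (h : ∀ x, tv ((C.P ^ t) x) C.π ≤ b) : C.d t ≤ b :=
  have := C.nonempty_states
  ciSup_le h

lemma exists_tv_eq_d (t : ℕ) : ∃ x, tv ((C.P ^ t) x) C.π = C.d t :=
  have := C.nonempty_states
  exists_eq_ciSup_of_finite (f := fun x => tv ((C.P ^ t) x) C.π)

lemma d_nonneg (t : ℕ) : 0 ≤ C.d t := by
  obtain ⟨x, hx⟩ := exists_tv_eq_d (C := C) t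
  rw [← hx]; exact tv_nonneg _ _

lemma tv_le_one (t : ℕ) (x : V) : tv ((C.P ^ t) x) C.π ≤ 1 := by
  have : ∑ y, |(C.P ^ t) x y - C.π y| ≤ ∑ y, ((C.P ^ t) x y + C.π y) :=
    Finset.sum_le_sum fun y _ => by
      have h1 := pow_nonneg' (C := C) t x y
      have h2 := C.π_nonneg y
      rw [abs_le]; constructor <;> linarith
  rw [Finset.sum_add_distrib, pow_sum, C.π_sum] at this
  rw [tv]; linarith

lemma tv_succ_le_avg (t : ℕ) (x : V) :
    tv ((C.P ^ (t + 1)) x) C.π ≤ C.avg (fun y => tv ((C.P ^ t) y) C.π) x := by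
  simp only [tv, avg_const_mul]
  refine mul_le_mul_of_nonneg_left ?_ (by norm_num)
  simp only [avg, Finset.mul_sum]
  rw [Finset.sum_comm]
  refine Finset.sum_le_sum fun z _ => ?_
  have : (C.P ^ (t + 1)) x z - C.π z = ∑ y, C.P x y * ((C.P ^ t) y z - C.π z) := by
    rw [pow_succ_apply, avg]
    simp only [mul_sub, Finset.sum_sub_distrib, ← Finset.sum_mul, C.P_sum, one_mul]
  rw [this]
  refine (Finset.abs_sum_le_sum_abs _ _).trans (Finset.sum_le_sum fun y _ => ?_)
  rw [abs_mul, abs_of_nonneg (C.P_nonneg x y)]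

lemma tv_antitone (x : V) : Antitone fun t => tv ((C.P ^ t) x) C.π := by
  refine antitone_nat_of_succ_le fun t => ?_
  simp only [tv]
  refine mul_le_mul_of_nonneg_left ?_ (by norm_num)
  calc ∑ z, |(C.P ^ (t + 1)) x z - C.π z|
      ≤ ∑ z, ∑ y, |(C.P ^ t) x y - C.π y| * C.P y z := by
        refine Finset.sum_le_sum fun z _ => ?_
        have : (C.P ^ (t + 1)) x z - C.π z = ∑ y, ((C.P ^ t) x y - C.π y) * C.P y z := by
          rw [pow_succ_apply', ← C.stationary z, ← Finset.sum_sub_distrib]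
          exact Finset.sum_congr rfl fun y _ => by ring
        rw [this]
        refine (Finset.abs_sum_le_sum_abs _ _).trans (Finset.sum_le_sum fun y _ => ?_)
        rw [abs_mul, abs_of_nonneg (C.P_nonneg y z)]
    _ = _ := by
        rw [Finset.sum_comm]
        simp only [← Finset.mul_sum, C.P_sum, mul_one]

lemma d_antitone : Antitone C.d := fun _ _ hst =>
  d_le fun x => (tv_antitone x hst).trans (tv_le_d _ x)

lemma sum_sub_sum_le_tv (t : ℕ) (x : V) {h : V → ℝ} (h0 : ∀ y, 0 ≤ h y) (h1 : ∀ y, h y ≤ 1) :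
    ∑ y, (C.P ^ t) x y * h y - ∑ y, C.π y * h y ≤ tv ((C.P ^ t) x) C.π := by
  have hz : ∑ y, ((C.P ^ t) x y - C.π y) = 0 := by
    rw [Finset.sum_sub_distrib, pow_sum, C.π_sum, sub_self]
  calc ∑ y, (C.P ^ t) x y * h y - ∑ y, C.π y * h y
      = ∑ y, ((C.P ^ t) x y - C.π y) * h y := by
        rw [← Finset.sum_sub_distrib]; exact Finset.sum_congr rfl fun y _ => by ring
    _ ≤ ∑ y, (1 / 2 * ((C.P ^ t) x y - C.π y) + 1 / 2 * |(C.P ^ t) x y - C.π y|) := by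
        refine Finset.sum_le_sum fun y _ => ?_
        have a := h0 y
        have b := h1 y
        rcases abs_cases ((C.P ^ t) x y - C.π y) with ⟨e, hs⟩ | ⟨e, hs⟩ <;> rw [e] <;> nlinarith
    _ = _ := by
        rw [Finset.sum_add_distrib, ← Finset.mul_sum, hz, ← Finset.mul_sum, tv]; ring

/-- Submultiplicativity of the distance to stationarity. -/
lemma d_add_le (s t : ℕ) : C.d (s + t) ≤ 2 * C.d s * C.d t := by
  refine d_le fun x => ?_
  have key : ∀ z, (C.P ^ (s + t)) x z - C.π z =
      ∑ y, ((C.P ^ s) x y - C.π y) * ((C.P ^ t) y z - C.π z) := by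
    intro z
    have hst : ∑ y, C.π y * (C.P ^ t) y z = C.π z := by
      induction t generalizing z with
      | zero => simp [Matrix.one_apply]
      | succ t ih =>
        calc ∑ y, C.π y * (C.P ^ (t + 1)) y z
            = ∑ y, C.π y * C.avg (fun w => (C.P ^ t) w z) y := by simp only [pow_succ_apply]
          _ = C.π z := by rw [sum_pi_avg, ih]
    have e : ∀ y, ((C.P ^ s) x y - C.π y) * ((C.P ^ t) y z - C.π z) =
        (C.P ^ s) x y * (C.P ^ t) y z - C.π y * (C.P ^ t) y z - (C.P ^ s) x y * C.π z
          + C.π y * C.π z := fun y => by ring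
    rw [pow_add, Matrix.mul_apply]
    simp only [e, Finset.sum_add_distrib, Finset.sum_sub_distrib, ← Finset.sum_mul, hst,
      pow_sum, C.π_sum]
    ring
  have hrow : ∀ y, ∑ z, |(C.P ^ t) y z - C.π z| ≤ 2 * C.d t := fun y => by
    have := tv_le_d (C := C) t y
    rw [tv] at this; linarith
  have hx : ∑ y, |(C.P ^ s) x y - C.π y| ≤ 2 * C.d s := by
    have := tv_le_d (C := C) s x
    rw [tv] at this; linarith
  have : ∑ z, |(C.P ^ (s + t)) x z - C.π z| ≤ 2 * C.d s * (2 * C.d t) := by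
    calc ∑ z, |(C.P ^ (s + t)) x z - C.π z|
        ≤ ∑ z, ∑ y, |(C.P ^ s) x y - C.π y| * |(C.P ^ t) y z - C.π z| := by
          refine Finset.sum_le_sum fun z _ => ?_
          rw [key z]
          refine (Finset.abs_sum_le_sum_abs _ _).trans (Finset.sum_le_sum fun y _ => ?_)
          rw [abs_mul]
      _ = ∑ y, |(C.P ^ s) x y - C.π y| * ∑ z, |(C.P ^ t) y z - C.π z| := by
          rw [Finset.sum_comm]; simp only [Finset.mul_sum]
      _ ≤ ∑ y, |(C.P ^ s) x y - C.π y| * (2 * C.d t) :=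
          Finset.sum_le_sum fun y _ => mul_le_mul_of_nonneg_left (hrow y) (abs_nonneg _)
      _ ≤ 2 * C.d s * (2 * C.d t) := by
          rw [← Finset.sum_mul]
          exact mul_le_mul_of_nonneg_right hx (by linarith [d_nonneg (C := C) t])
  rw [tv]; linarith

lemma d_mul_le {t : ℕ} (ht : C.d t ≤ 1 / 4) (k : ℕ) : C.d (k * t) ≤ (1 / 2) ^ k := by
  induction k with
  | zero => simpa using d_le (C := C) fun x => tv_le_one 0 x
  | succ k ih =>
    rw [Nat.succ_mul, pow_succ]
    refine (d_add_le _ _).trans ?_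
    nlinarith [d_nonneg (C := C) t, d_nonneg (C := C) (k * t)]

/-- Cauchy–Schwarz bound of the distance to stationarity by the return probability. -/
lemma tv_sq_le (hrev : C.IsReversible) (hpi : ∀ x, 0 < C.π x) (o : V) (s : ℕ) :
    4 * tv ((C.P ^ s) o) C.π ^ 2 ≤ (C.P ^ (2 * s)) o o / C.π o - 1 := by
  have h := Finset.sq_sum_div_le_sum_sq_div Finset.univ
    (fun y => |(C.P ^ s) o y - C.π y|) (g := C.π) fun y _ => hpi y
  rw [C.π_sum, div_one] at h
  have e : ∑ y, |(C.P ^ s) o y - C.π y| ^ 2 / C.π y = (C.P ^ (2 * s)) o o / C.π o - 1 := by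
    have e1 : ∀ y, |(C.P ^ s) o y - C.π y| ^ 2 / C.π y =
        (C.P ^ s) o y * (C.P ^ s) y o / C.π o - 2 * (C.P ^ s) o y + C.π y := fun y => by
      have := pow_reversible hrev s o y
      have ho := (hpi o).ne'
      have hy := (hpi y).ne'
      rw [sq_abs]
      field_simp
      linear_combination (C.P ^ s) o y * this
    simp only [e1, Finset.sum_add_distrib, Finset.sum_sub_distrib, ← Finset.mul_sum,
      ← Finset.sum_div, pow_sum, C.π_sum]
    rw [two_mul s, pow_add, Matrix.mul_apply]; ring
  rw [e] at h
  calc 4 * tv ((C.P ^ s) o) C.π ^ 2 = (∑ y, |(C.P ^ s) o y - C.π y|) ^ 2 := by rw [tv]; ring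
    _ ≤ _ := h

end Distance

/-! ### Avoiding a vertex, and its relation to mixing. -/

section Survival

variable [DecidableEq V]

/-- `survival C o t x` is the probability that the chain started at `x` has not visited `o` up
to time `t`. -/
def survival (C : MarkovChain V) (o : V) : ℕ → V → ℝ
  | 0 => fun x => if x = o then 0 else 1
  | t + 1 => fun x => if x = o then 0 else C.avg (survival C o t) x

variable {o : V}

lemma survival_self (t : ℕ) : C.survival o t o = 0 := by cases t <;> simp [survival]

lemma survival_succ {x : V} (hx : x ≠ o) (t : ℕ) :
    C.survival o (t + 1) x = C.avg (C.survival o t) x := by simp [survival, hx]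

lemma survival_nonneg (t : ℕ) (x : V) : 0 ≤ C.survival o t x := by
  induction t generalizing x with
  | zero => simp only [survival]; split_ifs <;> norm_num
  | succ t ih =>
    simp only [survival]; split_ifs
    · exact le_rfl
    · exact le_avg_of_le ih x

lemma survival_le_one (t : ℕ) (x : V) : C.survival o t x ≤ 1 := by
  induction t generalizing x with
  | zero => simp only [survival]; split_ifs <;> norm_num
  | succ t ih =>
    simp only [survival]; split_ifs
    · norm_num
    · exact avg_le_of_le ih x

/-- Avoidance of `o` is only required after time `t`; during the first `t` steps the chain moves
freely. -/
lemma survival_add_le (t s : ℕ) (x : V) :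
    C.survival o (t + s) x ≤ ∑ y, (C.P ^ t) x y * C.survival o s y := by
  induction t generalizing x with
  | zero => simp [Matrix.one_apply]
  | succ t ih =>
    by_cases hx : x = o
    · rw [hx, survival_self]
      exact Finset.sum_nonneg fun y _ => mul_nonneg (pow_nonneg' _ _ _) (survival_nonneg _ _)
    rw [show t + 1 + s = t + s + 1 by ring, survival_succ hx]
    refine (avg_mono ih x).trans (le_of_eq ?_)
    simp only [avg, Finset.mul_sum, pow_succ_apply, Finset.sum_mul]
    rw [Finset.sum_comm]
    exact Finset.sum_congr rfl fun y _ => Finset.sum_congr rfl fun z _ => by ring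

/-- `survival` is obtained by iterating the transition operator killed at `o`, which is
self-adjoint, so steps can be moved from one factor to the other. -/
lemma ip_survival (hrev : C.IsReversible) (s r : ℕ) :
    C.ip (C.survival o s) (C.survival o r) = ∑ x, C.π x * C.survival o (s + r) x := by
  have hstep : ∀ s r, C.ip (C.survival o s) (C.avg (C.survival o r)) =
      C.ip (C.survival o s) (C.survival o (r + 1)) := fun s r => by
    refine Finset.sum_congr rfl fun x _ => ?_
    by_cases hx : x = o
    · rw [hx, survival_self]; ring
    · rw [survival_succ hx]
  induction s generalizing r with
  | zero =>
    refine Finset.sum_congr rfl fun x _ => ?_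
    by_cases hx : x = o
    · simp only [hx, survival_self]; ring
    · simp [survival, hx]
  | succ s ih =>
    rw [ip_comm, ← hstep, ip_avg_symm hrev, ip_comm, hstep, ih]
    congr! 3; omega

/-- `hK` says that the killed operator has quadratic form at most 1 - 1/(2R), which gives decay at
this rate by `decay_of_quadratic_bound`. -/
lemma sum_survival_le (hrev : C.IsReversible) (hlazy : C.IsLazy) {R : ℝ} (hR : 1 ≤ R)
    (hK : ∀ f, f o = 0 → C.ip f f ≤ 2 * R * C.energy f) (t : ℕ) :
    ∑ x, C.π x * C.survival o t x ≤ Real.exp (-t / (2 * R)) := by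
  set l : ℝ := 1 - 1 / (2 * R) with hl
  have hl0 : 0 < l := by
    have : 1 / (2 * R) < 1 := by rw [div_lt_one (by linarith)]; linarith
    linarith
  have hstep : ∀ s r, C.ip (C.survival o s) (C.avg (C.survival o r)) =
      ∑ x, C.π x * C.survival o (s + r + 1) x := fun s r => by
    rw [add_assoc, ← ip_survival hrev]
    refine Finset.sum_congr rfl fun x _ => ?_
    by_cases hx : x = o
    · rw [hx, survival_self]; ring
    · rw [survival_succ hx]
  have hdec := decay_of_quadratic_bound hlazy (k := C.survival o)
    (c := fun t => ∑ x, C.π x * C.survival o t x) hl0 (ip_survival hrev) hstep (fun s => by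
      have h := hK _ (survival_self (C := C) (o := o) s)
      rw [energy_eq] at h
      have h2 : 1 / (2 * R) * C.ip (C.survival o s) (C.survival o s) ≤
          C.ip (C.survival o s) (C.survival o s) -
            C.ip (C.survival o s) (C.avg (C.survival o s)) := by
        rw [one_div, ← div_eq_inv_mul, div_le_iff₀ (by linarith)]; linarith
      rw [hl]; linarith)
  have hpow : ∑ x, C.π x * C.survival o t x ≤ l ^ t := by
    induction t with
    | zero =>
      rw [pow_zero, ← C.π_sum]
      exact Finset.sum_le_sum fun x _ =>
        mul_le_of_le_one_right (C.π_nonneg x) (survival_le_one _ _)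
    | succ t ih =>
      rw [pow_succ']
      exact (hdec t).trans (mul_le_mul_of_nonneg_left ih hl0.le)
  refine hpow.trans ?_
  rw [show -(t : ℝ) / (2 * R) = t * (-(1 / (2 * R))) by ring, Real.exp_nat_mul]
  refine pow_le_pow_left₀ hl0.le ?_ t
  have := Real.add_one_le_exp (-(1 / (2 * R)))
  rw [hl]; linarith

/-- After a visit to `o` at some time r ≤ t, the chain is at `o` at time `t` with probability
Pᵗ⁻ʳ(o,o), which is at least Pᵗ(o,o) since return probabilities decrease. -/
lemma one_sub_survival_mul_le (hrev : C.IsReversible) (hlazy : C.IsLazy) (ho : 0 < C.π o)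
    (t : ℕ) (x : V) : (1 - C.survival o t x) * (C.P ^ t) o o ≤ (C.P ^ t) x o := by
  by_cases hx : x = o
  · rw [hx, survival_self]; simp
  induction t generalizing x with
  | zero => simp [survival, hx]
  | succ t ih =>
    have hstep : ∀ y, (C.P ^ t) o o * (1 - C.survival o t y) ≤ (C.P ^ t) y o := fun y => by
      by_cases hy : y = o
      · rw [hy, survival_self]; simp
      · rw [mul_comm]; exact ih y hy
    have h1 := avg_mono (C := C) hstep x
    rw [avg_const_mul, avg_sub, avg_const, ← survival_succ hx, ← pow_succ_apply] at h1
    refine le_trans ?_ h1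
    rw [mul_comm]
    exact mul_le_mul_of_nonneg_right (return_antitone hrev hlazy ho (Nat.le_succ t))
      (by linarith [survival_le_one (C := C) (o := o) (t + 1) x])

/-- Started at `o`, the chain is mixed once the stationary chain has visited `o`. -/
lemma tv_le_of_sum_survival_le (hrev : C.IsReversible) (hlazy : C.IsLazy)
    (hpi : ∀ x, 0 < C.π x) {s : ℕ} {δ : ℝ} (hδ0 : 0 ≤ δ) (hδ : δ ≤ 1 / 2)
    (h : ∑ x, C.π x * C.survival o (2 * s) x ≤ δ ^ 2) : tv ((C.P ^ s) o) C.π ≤ δ := by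
  -- Average `one_sub_survival_mul_le` over `π`; stationarity turns the right side into `π o`.
  have h1 : (1 - ∑ x, C.π x * C.survival o (2 * s) x) * (C.P ^ (2 * s)) o o ≤ C.π o := by
    calc _ = ∑ x, C.π x * ((1 - C.survival o (2 * s) x) * (C.P ^ (2 * s)) o o) := by
          simp only [sub_mul, mul_sub, one_mul, Finset.sum_sub_distrib, ← Finset.sum_mul,
            C.π_sum, ← mul_assoc]
      _ ≤ ∑ x, C.π x * (C.P ^ (2 * s)) x o := Finset.sum_le_sum fun x _ =>
          mul_le_mul_of_nonneg_left (one_sub_survival_mul_le hrev hlazy (hpi o) _ x)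
            (C.π_nonneg x)
      _ = ∑ x, C.π o * (C.P ^ (2 * s)) o x := by simp only [pow_reversible hrev _ _ o]
      _ = C.π o := by rw [← Finset.mul_sum, pow_sum, mul_one]
  have h2 := tv_sq_le hrev hpi o s
  have hq := pow_nonneg' (C := C) (2 * s) o o
  have h3 : (1 - δ ^ 2) * ((C.P ^ (2 * s)) o o / C.π o) ≤ 1 := by
    rw [← mul_div_assoc, div_le_one (hpi o)]
    exact (mul_le_mul_of_nonneg_right (by linarith) hq).trans h1
  -- The form 1 + 4δ² is chosen so that `tv_sq_le` returns exactly `δ`.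
  have h4 : (C.P ^ (2 * s)) o o / C.π o ≤ 1 + 4 * δ ^ 2 := by
    have hd : δ ^ 2 ≤ 1 / 4 := by nlinarith
    have : 1 ≤ (1 - δ ^ 2) * (1 + 4 * δ ^ 2) := by nlinarith [sq_nonneg δ]
    exact le_of_mul_le_mul_left (h3.trans this) (by linarith)
  exact abs_le_of_sq_le_sq' (by linarith) hδ0 |>.2

/-- If `o` is hit by time `t`, at least `s` steps remain, and the distance started from `o` is
decreasing in time. -/
lemma tv_le_survival_add (t s : ℕ) (x : V) :
    tv ((C.P ^ (t + s)) x) C.π ≤ C.survival o t x + tv ((C.P ^ s) o) C.π := by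
  by_cases hx : x = o
  · rw [hx, survival_self, zero_add]; exact tv_antitone o (Nat.le_add_left s t)
  induction t generalizing x with
  | zero =>
    simp only [survival, hx, if_false]
    linarith [tv_le_one (C := C) (0 + s) x, tv_nonneg ((C.P ^ s) o) C.π]
  | succ t ih =>
    have hstep : ∀ y, tv ((C.P ^ (t + s)) y) C.π ≤
        C.survival o t y + tv ((C.P ^ s) o) C.π := fun y => by
      by_cases hy : y = o
      · rw [hy, survival_self, zero_add]; exact tv_antitone o (Nat.le_add_left s t)
      · exact ih y hy
    rw [show t + 1 + s = t + s + 1 by ring, survival_succ hx]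
    refine (tv_succ_le_avg _ _).trans ((avg_mono hstep x).trans (le_of_eq ?_))
    rw [avg_add, avg_const]

/-- The law at time `t` is compared with `π` on the test function `survival o s`, which takes values
in [0,1]. -/
lemma survival_le_d_add (t s : ℕ) (x : V) :
    C.survival o (t + s) x ≤ C.d t + ∑ y, C.π y * C.survival o s y := by
  have h1 := survival_add_le (C := C) (o := o) t s x
  have h2 := sum_sub_sum_le_tv (C := C) t x (survival_nonneg (C := C) (o := o) s)
    (survival_le_one s)
  linarith [tv_le_d (C := C) t x]

end Survival

end MarkovChain

/-! ### Mean and variance of the hitting time. -/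

namespace MarkovChain

variable {V : Type*} [Fintype V] {C : MarkovChain V} {o : V}

/-- The equation `f = P f + g` off `o`, `f o = 0` has a solution. -/
lemma exists_dirichlet_solution [DecidableEq V] (hpi : ∀ x, 0 < C.π x) {K : ℝ}
    (hK : ∀ f, f o = 0 → C.ip f f ≤ K * C.energy f) (g : V → ℝ) :
    ∃ f : V → ℝ, f o = 0 ∧ ∀ x, x ≠ o → f x = C.avg f x + g x := by
  let L : (V → ℝ) →ₗ[ℝ] (V → ℝ) :=
    { toFun := fun f x => if x = o then f o else f x - C.avg f x
      map_add' := fun f h => by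
        funext x
        have := avg_add (C := C) f h x
        simp only [Pi.add_apply]
        split_ifs
        · rfl
        · change f x + h x - C.avg (fun y => f y + h y) x = _
          rw [this]; ring
      map_smul' := fun c f => by
        funext x
        have := avg_const_mul (C := C) c f x
        simp only [Pi.smul_apply, smul_eq_mul, RingHom.id_apply]
        split_ifs
        · rfl
        · change c * f x - C.avg (fun y => c * f y) x = _
          rw [this]; ring }
  -- A function in the kernel vanishes at `o` and is harmonic elsewhere, so it has zero energy and
  -- is 0 by `hK`. In finite dimension injectivity yields existence.
  have hinj : Function.Injective L := by
    rw [← LinearMap.ker_eq_bot, LinearMap.ker_eq_bot']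
    intro f hf
    have hfx : ∀ x, (if x = o then f o else f x - C.avg f x) = 0 := fun x => congrFun hf x
    have hfo : f o = 0 := by simpa using hfx o
    have he : C.energy f = 0 := by
      rw [energy_eq, ip, ip, ← Finset.sum_sub_distrib]
      refine Finset.sum_eq_zero fun x _ => ?_
      by_cases hx : x = o
      · rw [hx, hfo]; ring
      · have := hfx x
        rw [if_neg hx] at this
        linear_combination C.π x * f x * this
    by_contra hne
    have h1 := hK f hfo
    rw [he, mul_zero] at h1
    exact absurd (ip_self_pos hpi hne) (not_lt.2 h1)
  obtain ⟨f, hf⟩ := LinearMap.surjective_of_injective hinj (fun x => if x = o then 0 else g x)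
  have hfx : ∀ x, (if x = o then f o else f x - C.avg f x) = if x = o then 0 else g x :=
    fun x => congrFun hf x
  refine ⟨f, by simpa using hfx o, fun x hx => ?_⟩
  have := hfx x
  rw [if_neg hx, if_neg hx] at this
  linarith

/-- Minimum principle. Strictness forces the minimum to be at `o` without any use of connectedness.
-/
lemma nonneg_of_avg_lt {f : V → ℝ} (hfo : 0 ≤ f o) (hf : ∀ x, x ≠ o → C.avg f x < f x) (x : V) :
    0 ≤ f x := by
  have : Nonempty V := ⟨o⟩
  obtain ⟨m, hm⟩ := Finite.exists_min f
  by_cases hmo : m = o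
  · exact hfo.trans (hmo ▸ hm x)
  · exact absurd (le_avg_of_le (C := C) hm m) (not_le.2 (hf m hmo))

/-- `μ` and `v` are the mean and the variance of the hitting time of `o`, as solutions of the
corresponding Dirichlet problems. -/
structure HittingMoments (C : MarkovChain V) (o : V) (μ v : V → ℝ) : Prop where
  mean_self : μ o = 0
  mean_eq : ∀ x, x ≠ o → μ x = C.avg μ x + 1
  mean_nonneg : ∀ x, 0 ≤ μ x
  var_self : v o = 0
  var_eq : ∀ x, x ≠ o → v x = C.avg v x + C.avg (fun y => (μ y - μ x + 1) ^ 2) x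
  var_nonneg : ∀ x, 0 ≤ v x

lemma exists_hittingMoments (hpi : ∀ x, 0 < C.π x) {K : ℝ}
    (hK : ∀ f, f o = 0 → C.ip f f ≤ K * C.energy f) :
    ∃ μ v, C.HittingMoments o μ v := by
  classical
  obtain ⟨μ, h0, h1⟩ := exists_dirichlet_solution hpi hK fun _ => 1
  have h2 : ∀ x, 0 ≤ μ x := nonneg_of_avg_lt h0.ge fun x hx => by linarith [h1 x hx]
  obtain ⟨v, h3, h4⟩ := exists_dirichlet_solution hpi hK
    fun x => C.avg (fun y => (μ y - μ x + 1) ^ 2) x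
  refine ⟨μ, v, h0, h1, h2, h3, h4, fun x => ?_⟩
  -- `v` is only weakly superharmonic off `o`; adding `δ * μ` makes this strict, and a small `δ`
  -- then rules out `v x < 0`.
  have key : ∀ δ : ℝ, 0 < δ → 0 ≤ v x + δ * μ x := fun δ hδ => by
    refine nonneg_of_avg_lt (C := C) (o := o) (f := fun y => v y + δ * μ y)
      (by simp [h0, h3]) (fun y hy => ?_) x
    rw [avg_add, avg_const_mul]
    have := le_avg_of_le (C := C) (c := 0) (f := fun z => (μ z - μ y + 1) ^ 2)
      (fun z => sq_nonneg _) y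
    nlinarith [h1 y hy, h4 y hy]
  by_contra! hv
  have hp : 0 < μ x + 1 := by linarith [h2 x]
  have := key (-v x / (2 * (μ x + 1))) (div_pos (by linarith) (by linarith))
  have e : -v x / (2 * (μ x + 1)) * μ x ≤ -v x / 2 := by
    rw [div_mul_eq_mul_div, div_le_div_iff₀ (by linarith) (by norm_num)]
    nlinarith
  linarith

namespace HittingMoments

variable {μ v : V → ℝ}

/-- Second moment of the hitting time around `s`. -/
lemma second_moment (h : C.HittingMoments o μ v) {x : V} (hx : x ≠ o) (s : ℝ) :
    C.avg (fun y => v y + (μ y - (s - 1)) ^ 2) x = v x + (μ x - s) ^ 2 := by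
  have e : ∀ y, v y + (μ y - (s - 1)) ^ 2 =
      v y + (μ y - μ x + 1) ^ 2 + ((2 * (μ x - s)) * (μ y) + (s ^ 2 - μ x ^ 2
        + 2 * μ x - 2 * s)) := fun y => by ring
  simp only [e]
  rw [avg_add, avg_add, avg_add, avg_const_mul, avg_const]
  linear_combination -h.var_eq x hx - 2 * (μ x - s) * h.mean_eq x hx

variable [DecidableEq V]

/-- Upper tail bound of Chebyshev type. -/
lemma survival_mul_sq_le (h : C.HittingMoments o μ v) (t : ℕ) (s : ℝ) (hs : s ≤ t) (x : V) :
    C.survival o t x * (t - s) ^ 2 ≤ v x + (μ x - s) ^ 2 := by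
  by_cases hx : x = o
  · rw [hx, survival_self, zero_mul, h.var_self]; positivity
  -- One step lowers both `t` and `s` by 1, so `t - s` is preserved while `second_moment` transports
  -- the right side.
  induction t generalizing x s with
  | zero =>
    simp only [survival, hx, if_false, Nat.cast_zero] at hs ⊢
    nlinarith [h.mean_nonneg x, h.var_nonneg x]
  | succ t ih =>
    rw [survival_succ hx, ← h.second_moment hx, mul_comm, ← avg_const_mul]
    refine avg_mono (fun y => ?_) x
    push_cast at hs ⊢
    by_cases hy : y = o
    · rw [hy, survival_self, mul_zero, h.var_self]; positivity
    · have := ih (s - 1) (by linarith) y hy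
      rw [mul_comm]
      convert this using 3
      ring

/-- Lower tail bound of Chebyshev type. -/
lemma one_sub_survival_mul_sq_le (h : C.HittingMoments o μ v) (t : ℕ) (s : ℝ) (hs : t ≤ s)
    (x : V) : (1 - C.survival o t x) * (s - t) ^ 2 ≤ v x + (μ x - s) ^ 2 := by
  have h0 : (0 : ℝ) ≤ t := t.cast_nonneg
  by_cases hx : x = o
  · rw [hx, survival_self, h.var_self, h.mean_self]; nlinarith
  induction t generalizing x s with
  | zero =>
    simp only [survival, hx, if_false]
    nlinarith [sq_nonneg (μ x - s), h.var_nonneg x]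
  | succ t ih =>
    have ht : (0 : ℝ) ≤ t := t.cast_nonneg
    push_cast at hs ⊢
    rw [survival_succ hx, ← h.second_moment hx]
    have e : (1 - C.avg (C.survival o t) x) * (s - (t + 1)) ^ 2 =
        C.avg (fun y => (s - (t + 1)) ^ 2 * (1 - C.survival o t y)) x := by
      rw [avg_const_mul, avg_sub, avg_const]; ring
    rw [e]
    refine avg_mono (fun y => ?_) x
    by_cases hy : y = o
    · rw [hy, survival_self, h.var_self, h.mean_self]; nlinarith
    · have := ih (s - 1) (by linarith) y ht hy
      rw [mul_comm]
      convert this using 3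
      ring

end HittingMoments

open Classical in
/-- On a tree, the variance of a hitting time is controlled by its mean. -/
lemma HittingMoments.var_le {G : SimpleGraph V} {μ v : V → ℝ} (h : C.HittingMoments o μ v)
    (hT : G.IsTree) (hon : C.IsOn G) (hrev : C.IsReversible) {K : ℝ} (hK0 : 0 ≤ K)
    (hK : ∀ f, f o = 0 → C.ip f f ≤ K * C.energy f) (x : V) :
    v x ≤ 2 * K * μ x := by
  have hC := hT.connected
  have hpi := hon.pi_pos hC hrev
  induction hn : G.dist x o generalizing x with
  | zero =>
    rw [hC.dist_eq_zero_iff.1 hn, h.var_self, h.mean_self, mul_zero]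
  | succ n ih =>
    have hxo : x ≠ o := by rintro rfl; simp at hn
    obtain ⟨p, hxp, hp⟩ := hC.exists_adj_dist_add_one hxo
    have hvp := ih p (by omega)
    -- The mean and variance increments from `p` to `x` belong to the crossing time from `x` to `p`,
    -- which depends only on the chain inside `D`.
    set D := G.branch x p with hD
    have hoD : o ∉ D := by
      simp only [hD, SimpleGraph.branch, Set.mem_ofPred_eq]
      rw [SimpleGraph.dist_comm, SimpleGraph.dist_comm (v := p)]; omega
    have hxD : x ∈ D := hxp.mem_branch
    have hpD : p ∉ D := SimpleGraph.notMem_branch_self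
    have hPz : ∀ {y z}, y ∈ D → z ∉ D → C.P y z ≠ 0 → y = x ∧ z = p := by
      intro y z hy hz h0
      have hadj := ((hon y z).1 ((C.P_nonneg y z).lt_of_ne' h0)).resolve_right
        fun e => hz (e ▸ hy)
      exact hT.eq_of_adj_branch hxp hadj hy hz
    have hout : ∀ (k : V → ℝ), k p = 0 → ∀ y ∈ D,
        C.avg (fun z => if z ∈ D then k z else 0) y = C.avg k y := by
      intro k hk y hy
      refine Finset.sum_congr rfl fun z _ => ?_
      beta_reduce
      split_ifs with hz
      · rfl
      · by_cases h0 : C.P y z = 0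
        · simp [h0]
        · rw [(hPz hy hz h0).2, hk]
    set c := C.π x * C.P x p with hc
    have hc0 : 0 < c := mul_pos (hpi x) ((hon x p).2 (Or.inl hxp))
    -- Green's formula on `D`: the only edge leaving `D` is `xp`, so the total Laplacian of `k` is
    -- its flux through this edge.
    have hflux : ∀ k : V → ℝ, (∀ z, z ∉ D → k z = 0) →
        ∑ y with y ∈ D, C.π y * (k y - C.avg k y) = c * k x := by
      intro k hk
      have h1 : ∑ y with y ∈ D, C.π y * (k y - C.avg k y) =
          ∑ y, (C.π y * k y * if y ∈ D then 1 - C.avg (fun z => if z ∈ D then 1 else 0) y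
            else 0) := by
        have h2 := ip_avg_symm hrev (fun z => if z ∈ D then (1 : ℝ) else 0) k
        have h3 : ∑ y with y ∈ D, C.π y * (k y - C.avg k y) =
            C.ip (fun z => if z ∈ D then (1 : ℝ) else 0) k -
            C.ip (fun z => if z ∈ D then (1 : ℝ) else 0) (C.avg k) := by
          rw [ip, ip, ← Finset.sum_sub_distrib, Finset.sum_filter]
          refine Finset.sum_congr rfl fun y _ => ?_
          split_ifs <;> ring
        rw [h3, h2, ip, ip, ← Finset.sum_sub_distrib]
        refine Finset.sum_congr rfl fun y _ => ?_
        split_ifs with hy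
        · ring
        · rw [hk y hy]; ring
      rw [h1, Finset.sum_eq_single x]
      · rw [if_pos hxD, hc]
        have : 1 - C.avg (fun z => if z ∈ D then 1 else 0) x = C.P x p := by
          have e : ∀ z, (1 : ℝ) - (if z ∈ D then 1 else 0) = if z ∈ D then 0 else 1 := fun z => by
            split_ifs <;> norm_num
          have e1 := avg_sub (C := C) (fun _ => 1) (fun z => if z ∈ D then 1 else 0) x
          rw [avg_const] at e1
          rw [← e1]
          simp only [e, avg]
          rw [Finset.sum_eq_single p]
          · rw [if_neg hpD, mul_one]
          · intro z _ hzp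
            split_ifs with hz
            · simp
            · by_contra h0
              rw [mul_one] at h0
              exact hzp (hPz hxD hz h0).2
          · simp
        rw [this]; ring
      · intro y _ hyx
        split_ifs with hy
        · have : C.avg (fun z => if z ∈ D then 1 else 0) y = 1 := by
            refine Eq.trans (Finset.sum_congr rfl fun z _ => ?_) (avg_const (C := C) 1 y)
            beta_reduce
            split_ifs with hz
            · rfl
            · by_cases h0 : C.P y z = 0
              · simp [h0]
              · exact absurd (hPz hy hz h0).1 hyx
          rw [this]; ring
        · ring
      · simp
    set m := ∑ y with y ∈ D, C.π y with hm
    have hm0 : 0 ≤ m := Finset.sum_nonneg fun y _ => C.π_nonneg y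
    -- On `D`, `f` and `w` are the first and second moments of the hitting time of `p`; hence `f -
    -- Pf = 1` and `w - Pw = 2f - 1` there.
    set f : V → ℝ := fun y => if y ∈ D then μ y - μ p else 0 with hf
    set w : V → ℝ := fun y => if y ∈ D then v y - v p + (μ y - μ p) ^ 2 else 0 with hw
    have hfoff : ∀ z, z ∉ D → f z = 0 := fun z hz => by simp [hf, hz]
    have hne : ∀ {y}, y ∈ D → y ≠ o := fun hy e => hoD (e ▸ hy)
    have hf1 : ∀ y ∈ D, f y - C.avg f y = 1 := fun y hy => by
      rw [hf, hout (fun z => μ z - μ p) (sub_self _) y hy, avg_sub, avg_const]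
      simp only [hy, if_true]
      linear_combination h.mean_eq y (hne hy)
    have hw1 : ∀ y ∈ D, w y - C.avg w y = 2 * f y - 1 := fun y hy => by
      have h2 := h.second_moment (hne hy) (μ p + 1)
      have e : ∀ z, v z - v p + (μ z - μ p) ^ 2 = v z + (μ z - (μ p + 1 - 1)) ^ 2 - v p :=
        fun z => by ring
      rw [hw, hout (fun z => v z - v p + (μ z - μ p) ^ 2) (by simp) y hy]
      simp only [e]
      rw [avg_sub, avg_const, h2]
      simp only [hf, hy, if_true]
      ring
    have hfx : c * f x = m := by
      rw [← hflux f hfoff, hm]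
      refine Finset.sum_congr rfl fun y hy => ?_
      rw [hf1 y (Finset.mem_filter.1 hy).2, mul_one]
    set I := ∑ y with y ∈ D, C.π y * f y with hI
    have hwx : c * w x = 2 * I - m := by
      rw [← hflux w (fun z hz => by simp [hw, hz]), hI, hm, Finset.mul_sum,
        ← Finset.sum_sub_distrib]
      refine Finset.sum_congr rfl fun y hy => ?_
      rw [hw1 y (Finset.mem_filter.1 hy).2]; ring
    have hIE : I = C.energy f := by
      rw [energy_eq, ip, ip, ← Finset.sum_sub_distrib, hI, Finset.sum_filter]
      refine Finset.sum_congr rfl fun y _ => ?_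
      split_ifs with hy
      · linear_combination -(C.π y * f y) * hf1 y hy
      · rw [hfoff y hy]; ring
    have hI0 : 0 ≤ I := hIE ▸ energy_nonneg f
    have hIsq : I ^ 2 ≤ m * C.ip f f := by
      refine (Finset.sum_sq_le_sum_mul_sum_of_sq_le_mul _ (f := C.π)
        (g := fun y => C.π y * f y * f y) (fun y _ => C.π_nonneg y)
        (fun y _ => by rw [mul_assoc]; exact mul_nonneg (C.π_nonneg y) (mul_self_nonneg _))
        (fun y _ => le_of_eq (by ring))).trans (mul_le_mul_of_nonneg_left ?_ hm0)
      exact Finset.sum_le_sum_of_subset_of_nonneg (Finset.filter_subset _ _) fun y _ _ => by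
        rw [mul_assoc]; exact mul_nonneg (C.π_nonneg y) (mul_self_nonneg _)
    -- I² ≤ m⟨f,f⟩ ≤ m K E(f), where E is the energy and E(f) = I; one factor `I` cancels.
    have hIm : I ≤ m * K := by
      rcases hI0.eq_or_lt with h0 | h0
      · rw [← h0]; positivity
      · have h1 := hK f (hfoff o hoD)
        rw [← hIE] at h1
        have h2 : I * I ≤ m * K * I := by nlinarith
        exact le_of_mul_le_mul_right h2 h0
    have hwf : w x ≤ 2 * K * f x := by
      refine le_of_mul_le_mul_left ?_ hc0
      rw [hwx, show c * (2 * K * f x) = 2 * K * (c * f x) by ring, hfx]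
      linarith
    simp only [hw, hf, hxD, if_true] at hwf
    -- Dropping the squared mean from `w x` gives the bound for the increment, which is added to the
    -- bound at `p`.
    nlinarith [sq_nonneg (μ x - μ p)]

end MarkovChain

/-! ### Mixing profile and window of a single tree chain. -/

namespace MarkovChain

/-- A lazy reversible nearest-neighbour chain on a tree with at least two vertices. -/
structure IsLazyTreeChain {V : Type*} [Fintype V] (C : MarkovChain V) (G : SimpleGraph V) :
    Prop where
  isTree : G.IsTree
  isOn : C.IsOn G
  isLazy : C.IsLazy
  isReversible : C.IsReversible
  two_le_card : 2 ≤ Fintype.card V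

variable {V : Type*} [Fintype V] {C : MarkovChain V} {G : SimpleGraph V}

lemma IsLazyTreeChain.pi_pos (h : C.IsLazyTreeChain G) (x : V) : 0 < C.π x :=
  h.isOn.pi_pos h.isTree.connected h.isReversible x

variable [DecidableEq V]

lemma tmix_le {t : ℕ} {ε : ℝ} (h : C.d t ≤ ε) : C.tmix ε ≤ t := Nat.sInf_le h

lemma lt_d_of_lt_tmix {t : ℕ} {ε : ℝ} (h : t < C.tmix ε) : ε < C.d t :=
  not_le.1 fun h' => absurd (tmix_le h') (not_le.2 h)

/-- If `d(t) > 1 - ε` for a lazy chain, then one more step cannot mix the chain. -/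
lemma le_d_succ (hlazy : C.IsLazy) {t : ℕ} {ε : ℝ} (h : 1 - ε ≤ C.d t) :
    (1 - ε) / 2 - ε ≤ C.d (t + 1) := by
  obtain ⟨x, hx⟩ := exists_tv_eq_d (C := C) t
  -- Indicator of the set A realising the total variation. Here Pᵗ(x,A) ≥ 1 - ε and π(A) ≤ ε, and
  -- laziness keeps at least half of the mass of A in place.
  set h' : V → ℝ := fun y => if C.π y < (C.P ^ t) x y then 1 else 0 with hh
  have h0 : ∀ y, 0 ≤ h' y := fun y => by simp only [hh]; split_ifs <;> norm_num
  have h1 : ∀ y, h' y ≤ 1 := fun y => by simp only [hh]; split_ifs <;> norm_num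
  have hz : ∑ y, ((C.P ^ t) x y - C.π y) = 0 := by
    rw [Finset.sum_sub_distrib, pow_sum, C.π_sum, sub_self]
  have htv : tv ((C.P ^ t) x) C.π = ∑ y, (C.P ^ t) x y * h' y - ∑ y, C.π y * h' y := by
    calc tv ((C.P ^ t) x) C.π
        = ∑ y, (1 / 2 * ((C.P ^ t) x y - C.π y) + 1 / 2 * |(C.P ^ t) x y - C.π y|) := by
          rw [Finset.sum_add_distrib, ← Finset.mul_sum, hz, ← Finset.mul_sum, tv]; ring
      _ = _ := by
          rw [← Finset.sum_sub_distrib]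
          refine Finset.sum_congr rfl fun y _ => ?_
          simp only [hh]
          split_ifs with hy
          · rw [abs_of_pos (by linarith)]; ring
          · rw [abs_of_nonpos (by linarith)]; ring
  have hP1 : ∑ y, (C.P ^ t) x y * h' y ≤ 1 := by
    rw [← pow_sum (C := C) t x]
    exact Finset.sum_le_sum fun y _ => mul_le_of_le_one_right (pow_nonneg' t x y) (h1 y)
  have hπ0 : 0 ≤ ∑ y, C.π y * h' y :=
    Finset.sum_nonneg fun y _ => mul_nonneg (C.π_nonneg y) (h0 y)
  have hstep : (∑ y, (C.P ^ t) x y * h' y) / 2 ≤ ∑ y, (C.P ^ (t + 1)) x y * h' y := by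
    have e : ∑ y, (C.P ^ (t + 1)) x y * h' y = ∑ y, (C.P ^ t) x y * C.avg h' y := by
      simp only [pow_succ_apply', avg, Finset.mul_sum, Finset.sum_mul]
      rw [Finset.sum_comm]
      exact Finset.sum_congr rfl fun y _ => Finset.sum_congr rfl fun z _ => by ring
    rw [e, Finset.sum_div]
    refine Finset.sum_le_sum fun y _ => ?_
    rw [mul_div_assoc]
    refine mul_le_mul_of_nonneg_left ?_ (pow_nonneg' t x y)
    calc h' y / 2 ≤ C.P y y * h' y := by nlinarith [h0 y, hlazy y]
      _ ≤ C.avg h' y := Finset.single_le_sum (f := fun z => C.P y z * h' z)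
          (fun z _ => mul_nonneg (C.P_nonneg y z) (h0 z)) (Finset.mem_univ y)
  have := sum_sub_sum_le_tv (C := C) (t + 1) x h0 h1
  linarith [tv_le_d (C := C) (t + 1) x]

namespace IsLazyTreeChain

lemma one_le_trel (h : C.IsLazyTreeChain G) : 1 ≤ C.trel :=
  MarkovChain.one_le_trel h.isOn h.isTree.connected h.isLazy h.isReversible h.two_le_card

/-- The mixing profile is governed by a single time `M`, the largest mean hitting time of a
central vertex. -/
lemma exists_mixing_center (h : C.IsLazyTreeChain G) : ∃ M : ℝ, 1 ≤ M ∧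
    (∀ (ε : ℝ) (t s : ℕ), 0 < ε → ε ≤ 1 → M + √(8 * C.trel * M / ε) ≤ t →
      2 * C.trel * Real.log (2 / ε) ≤ s → C.d (t + s) ≤ ε) ∧
    (∀ (ε : ℝ) (t s : ℕ), 0 < ε → ε ≤ 1 → C.d t ≤ 1 - ε →
      2 * C.trel * Real.log (2 / ε) ≤ s → M ≤ t + s + √(8 * C.trel * M / ε)) := by
  have hpi := h.pi_pos
  have hR := h.one_le_trel
  set R := C.trel with hRdef
  obtain ⟨o, ho⟩ := C.exists_center h.isTree.connected
  have hK : ∀ f, f o = 0 → C.ip f f ≤ 2 * R * C.energy f :=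
    ip_le_energy_of_center h.isTree h.isOn h.isReversible h.isLazy h.two_le_card ho
  obtain ⟨μ, v, hm⟩ := exists_hittingMoments hpi hK
  have hv := fun x => hm.var_le h.isTree h.isOn h.isReversible (by linarith) hK x
  have : Nonempty V := ⟨o⟩
  obtain ⟨z, hz⟩ := Finite.exists_max μ
  have hM : 1 ≤ μ z := by
    have : Nontrivial V := Fintype.one_lt_card_iff_nontrivial.1 h.two_le_card
    obtain ⟨y, hy⟩ := exists_ne o
    have h1 := le_avg_of_le (C := C) hm.mean_nonneg y
    linarith [hz y, hm.mean_eq y hy]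
  have hvM : ∀ x, v x ≤ 4 * R * μ z := fun x => by
    have := mul_le_mul_of_nonneg_left (hz x) (by linarith : 0 ≤ 4 * R)
    linarith [hv x]
  have hRM : 0 < R * μ z := by positivity
  have hexp : ∀ (ε : ℝ) (s : ℕ), 0 < ε → 2 * R * Real.log (2 / ε) ≤ s →
      Real.exp (-s / (2 * R)) ≤ ε / 2 := by
    intro ε s hε hs
    rw [← Real.le_log_iff_exp_le (by positivity), ← inv_div 2 ε, Real.log_inv, neg_div, neg_le_neg_iff,
      le_div_iff₀ (by positivity)]
    linarith
  refine ⟨μ z, hM, fun ε t s hε hε1 ht hs => d_le fun x => ?_,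
    fun ε t s hε hε1 hd hs => ?_⟩
  -- Split ε in two: by Chebyshev, `o` is missed up to time `t` with probability at most ε/2, and
  -- `s` further steps from `o` leave distance at most ε/2.
  · have h1 : tv ((C.P ^ s) o) C.π ≤ ε / 2 := by
      refine tv_le_of_sum_survival_le (o := o) h.isReversible h.isLazy hpi (by linarith)
        (by linarith) ((sum_survival_le h.isReversible h.isLazy hR hK _).trans ?_)
      have e : Real.exp (-((2 * s : ℕ) : ℝ) / (2 * R)) = Real.exp (-s / (2 * R)) ^ 2 := by
        rw [← Real.exp_nat_mul]; push_cast; ring_nf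
      rw [e]
      exact pow_le_pow_left₀ (Real.exp_pos _).le (hexp ε s hε hs) 2
    have h2 : C.survival o t x ≤ ε / 2 := by
      have hs0 := Real.sqrt_nonneg (8 * R * μ z / ε)
      have h3 := hm.survival_mul_sq_le t (μ x) (by linarith [hz x]) x
      rw [sub_self] at h3
      have h4 : 8 * R * μ z / ε ≤ (t - μ x) ^ 2 := by
        rw [← Real.sqrt_le_left (by linarith [hz x])]
        linarith [hz x]
      have h5 := mul_le_mul_of_nonneg_left h4 (survival_nonneg (C := C) (o := o) t x)
      have h6 : C.survival o t x * (8 * R * μ z / ε) ≤ 4 * R * μ z := by linarith [hvM x]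
      rw [← mul_div_assoc, div_le_iff₀ hε] at h6
      have h7 : 8 * (R * μ z) * C.survival o t x ≤ 8 * (R * μ z) * (ε / 2) := by linarith
      exact le_of_mul_le_mul_left h7 (by positivity)
    linarith [tv_le_survival_add (C := C) (o := o) t s x]
  -- From the farthest state `z`, `o` has been hit by time t + s with probability at least ε/2;
  -- Chebyshev forbids this if t + s is too far below the mean `μ z`.
  · by_cases hts : μ z ≤ (t + s : ℕ)
    · push_cast at hts
      linarith [Real.sqrt_nonneg (8 * R * μ z / ε)]
    push Not at hts
    have h1 := survival_le_d_add (C := C) (o := o) t s z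
    have h2 := (sum_survival_le h.isReversible h.isLazy hR hK s).trans (hexp ε s hε hs)
    have h3 := hm.one_sub_survival_mul_sq_le (t + s) (μ z) hts.le z
    rw [sub_self] at h3
    have h4 : ε / 2 * (μ z - (t + s : ℕ)) ^ 2 ≤ 4 * R * μ z := by
      have := mul_le_mul_of_nonneg_right (by linarith : ε / 2 ≤ 1 - C.survival o (t + s) z)
        (sq_nonneg (μ z - (t + s : ℕ)))
      linarith [hvM z]
    have h5 : (μ z - (t + s : ℕ)) ^ 2 ≤ 8 * R * μ z / ε := by
      rw [le_div_iff₀ hε]; linarith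
    have h6 := Real.le_sqrt_of_sq_le h5
    push_cast at h6
    linarith

/-- The infimum of an empty set of naturals is 0, so attainment needs some time with `d t ≤ ε`,
which the upper bound of `exists_mixing_center` supplies. -/
lemma d_tmix_le (h : C.IsLazyTreeChain G) {ε : ℝ} (hε : 0 < ε) : C.d (C.tmix ε) ≤ ε := by
  have hne : {t : ℕ | C.d t ≤ ε}.Nonempty := by
    obtain ⟨M, -, hU, -⟩ := h.exists_mixing_center
    exact ⟨_, (hU (min ε 1) _ _ (lt_min hε one_pos) (min_le_right _ _) (Nat.le_ceil _)
      (Nat.le_ceil _)).trans (min_le_left _ _)⟩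
  exact Nat.sInf_mem hne

lemma tmix_anti (h : C.IsLazyTreeChain G) {ε δ : ℝ} (hε : 0 < ε) (hεδ : ε ≤ δ) :
    C.tmix δ ≤ C.tmix ε :=
  tmix_le ((h.d_tmix_le hε).trans hεδ)

/-- Turns the log(1/ε) repetitions of `tmix` into a factor 2ε^(-1/2). -/
lemma succ_sq_le_two_pow (n : ℕ) : (n + 1) ^ 2 ≤ 4 * 2 ^ n := by
  induction n with
  | zero => norm_num
  | succ n ih =>
    rcases Nat.lt_or_ge n 2 with hn | hn
    · interval_cases n <;> norm_num
    · rw [pow_succ 2 n]; nlinarith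

/-- Bound of the mixing window by the relaxation and mixing times. -/
lemma tmix_sub_le (h : C.IsLazyTreeChain G) {ε : ℝ} (hε : 0 < ε) (hε4 : ε ≤ 1 / 4) :
    (C.tmix ε : ℝ) - (C.tmix (1 - ε) : ℝ) ≤
      35 * √(ε⁻¹ * C.trel * (C.tmix (1 / 4) : ℝ)) := by
  have hR := h.one_le_trel
  have hdτ := h.d_tmix_le (ε := 1 / 4) (by norm_num)
  set R := C.trel with hRdef
  set τ := C.tmix (1 / 4) with hτ
  have hτ0 : (0 : ℝ) ≤ τ := τ.cast_nonneg
  have hεi : 0 < ε⁻¹ := inv_pos.2 hε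
  -- If `τ` is comparable to `R`, submultiplicativity suffices: (n+1)τ ≤ 2ε^(-1/2) √(300Rτ), and
  -- 2√300 < 35. This case fixes the constant; the other one needs less than 13.
  by_cases hc : (τ : ℝ) ≤ 300 * R
  · obtain ⟨n, hn1, hn2⟩ := exists_nat_pow_near_of_lt_one hε (by linarith) (y := (1 / 2 : ℝ))
      (by norm_num) (by norm_num)
    have h1 : C.tmix ε ≤ (n + 1) * τ := tmix_le ((d_mul_le hdτ (n + 1)).trans hn1.le)
    have h2 : (C.tmix ε : ℝ) ≤ (n + 1) * τ := by exact_mod_cast h1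
    have h3 : ((n : ℝ) + 1) ^ 2 ≤ 4 * 2 ^ n := by exact_mod_cast succ_sq_le_two_pow n
    have h4 : (2 : ℝ) ^ n ≤ ε⁻¹ := by
      rw [le_inv_comm₀ (by positivity) hε, ← inv_pow, ← one_div]; exact hn2
    have h5 : ((n : ℝ) + 1) * τ / 35 ≤ √(ε⁻¹ * R * τ) := by
      refine Real.le_sqrt_of_sq_le ?_
      have h6 : ((n : ℝ) + 1) ^ 2 ≤ 4 * ε⁻¹ := h3.trans (by linarith)
      have h7 : (τ : ℝ) ^ 2 ≤ 300 * (R * τ) := by nlinarith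
      have h8 := mul_le_mul h6 h7 (sq_nonneg _) (by positivity)
      have h9 : 0 ≤ ε⁻¹ * R * τ := by positivity
      nlinarith
    have : (0 : ℝ) ≤ C.tmix (1 - ε) := Nat.cast_nonneg _
    linarith
  push Not at hc
  obtain ⟨M, hM1, hU, hL⟩ := h.exists_mixing_center
  rw [← hRdef] at hU hL
  -- The lower estimate at level 3/4, since d(τ) ≤ 1 - 3/4; the square root is absorbed by the
  -- arithmetic–geometric mean inequality.
  have hMτ : M ≤ 3 * τ := by
    have h1 := hL (3 / 4) τ ⌈2 * R * Real.log (2 / (3 / 4))⌉₊ (by norm_num) (by norm_num)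
      (by linarith) (Nat.le_ceil _)
    have hlog0 : 0 ≤ Real.log (2 / (3 / 4)) := Real.log_nonneg (by norm_num)
    have hlog : Real.log (2 / (3 / 4)) ≤ 5 / 3 :=
      (Real.log_le_sub_one_of_pos (by norm_num)).trans (by norm_num)
    have h2 := Nat.ceil_lt_add_one (a := 2 * R * Real.log (2 / (3 / 4))) (by positivity)
    have h3 : 2 * R * Real.log (2 / (3 / 4)) ≤ 2 * R * (5 / 3) :=
      mul_le_mul_of_nonneg_left hlog (by linarith)
    have h4 : √(8 * R * M / (3 / 4)) ≤ M / 2 + 16 / 3 * R := by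
      rw [Real.sqrt_le_left (by linarith)]
      nlinarith [sq_nonneg (M / 2 - 16 / 3 * R)]
    linarith
  set J := √(ε⁻¹ * R * τ) with hJ
  have hJ0 : 0 ≤ J := Real.sqrt_nonneg _
  have hJsq : J ^ 2 = ε⁻¹ * R * τ := Real.sq_sqrt (by positivity)
  have hε4' : 4 ≤ ε⁻¹ := by
    rw [le_inv_comm₀ (by norm_num) hε]; linarith
  have hRτ : 300 * R ^ 2 ≤ R * τ := by nlinarith
  have hJ1 : 30 ≤ J := by
    refine Real.le_sqrt_of_sq_le ?_
    have h1 : 300 ≤ R * τ := by nlinarith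
    nlinarith
  have hr : √(8 * R * M / ε) ≤ 5 * J := by
    rw [Real.sqrt_le_left (by linarith), mul_pow, hJsq, div_eq_mul_inv]
    have h1 : R * M ≤ R * (3 * τ) := mul_le_mul_of_nonneg_left hMτ (by linarith)
    have h2 := mul_le_mul_of_nonneg_left h1 hεi.le
    have h3 : 0 ≤ ε⁻¹ * R * τ := by positivity
    linarith
  have hlog0 : 0 ≤ Real.log (2 / ε) := Real.log_nonneg (by
    rw [le_div_iff₀ hε]; linarith)
  -- log u ≤ 2√u with u = 2/ε; then R√u ≤ J/4 because `τ` dominates 32R.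
  have hs : 2 * R * Real.log (2 / ε) ≤ J := by
    have h1 : Real.log (2 / ε) ≤ 2 * √(2 / ε) := by
      have h2 := Real.log_le_sub_one_of_pos (x := √(2 / ε)) (Real.sqrt_pos.2 (by positivity))
      rw [Real.log_sqrt (by positivity)] at h2
      linarith
    have h3 : R * √(2 / ε) ≤ J / 4 := by
      refine abs_le_of_sq_le_sq' ?_ (by linarith) |>.2
      rw [mul_pow, Real.sq_sqrt (by positivity), div_pow, hJsq, div_eq_mul_inv]
      have := mul_le_mul_of_nonneg_left hRτ hεi.le
      nlinarith
    have h4 := mul_le_mul_of_nonneg_left h1 (by linarith : 0 ≤ 2 * R)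
    linarith
  have hsc := Nat.ceil_lt_add_one (a := 2 * R * Real.log (2 / ε)) (by positivity)
  have hr0 := Real.sqrt_nonneg (8 * R * M / ε)
  have htc := Nat.ceil_lt_add_one (a := M + √(8 * R * M / ε)) (by positivity)
  have hup := tmix_le (hU ε _ _ hε (by linarith) (Nat.le_ceil _) (Nat.le_ceil _))
  have hup' : (C.tmix ε : ℝ) ≤ ⌈M + √(8 * R * M / ε)⌉₊ + ⌈2 * R * Real.log (2 / ε)⌉₊ := by
    exact_mod_cast hup
  have hlow := hL ε (C.tmix (1 - ε)) _ hε (by linarith) (h.d_tmix_le (by linarith))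
    (Nat.le_ceil _)
  linarith

/-- An eigenfunction for `lambda₂` has mean zero; test the signed measure Pᵗ(x,·) - π on it, at a
point where it is largest in absolute value. -/
lemma lambda₂_pow_le (h : C.IsLazyTreeChain G) (t : ℕ) : C.lambda₂ ^ t ≤ 2 * C.d t := by
  have hl := lambda₂_mem h.isOn h.isTree.connected h.isReversible h.two_le_card
  obtain ⟨φ, hφ0, hφ⟩ := hasEigenvalue_iff.1 hl.2
  have hmean : ∑ y, C.π y * φ y = 0 := by
    have h1 := sum_pi_avg (C := C) φ
    have h2 : ∑ y, C.π y * C.avg φ y = C.lambda₂ * ∑ y, C.π y * φ y := by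
      rw [Finset.mul_sum]
      exact Finset.sum_congr rfl fun y _ => by rw [hφ]; ring
    rw [h2] at h1
    have : (C.lambda₂ - 1) * ∑ y, C.π y * φ y = 0 := by linarith
    exact (mul_eq_zero.1 this).resolve_left (sub_ne_zero.2 hl.1)
  have hpow : ∀ x, ∑ y, (C.P ^ t) x y * φ y = C.lambda₂ ^ t * φ x := by
    induction t with
    | zero => simp [Matrix.one_apply]
    | succ t ih =>
      intro x
      have e : ∑ y, (C.P ^ (t + 1)) x y * φ y = C.avg (fun z => ∑ y, (C.P ^ t) z y * φ y) x := by
        simp only [avg, Finset.mul_sum, pow_succ_apply, Finset.sum_mul]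
        rw [Finset.sum_comm]
        exact Finset.sum_congr rfl fun y _ => Finset.sum_congr rfl fun z _ => by ring
      rw [e]
      simp only [ih, avg_const_mul, hφ]
      ring
  have := C.nonempty_states
  obtain ⟨x, hx⟩ := Finite.exists_max fun x => |φ x|
  have hx0 : 0 < |φ x| := by
    obtain ⟨y, hy⟩ := Function.ne_iff.1 hφ0
    exact (abs_pos.2 hy).trans_le (hx y)
  have hl0 : 0 ≤ C.lambda₂ := lambda₂_nonneg h.isOn h.isTree.connected h.isLazy h.isReversible
    h.two_le_card
  have key : C.lambda₂ ^ t * |φ x| ≤ 2 * C.d t * |φ x| := by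
    calc C.lambda₂ ^ t * |φ x| = |∑ y, ((C.P ^ t) x y - C.π y) * φ y| := by
          simp only [sub_mul, Finset.sum_sub_distrib, hpow, hmean, sub_zero]
          rw [abs_mul, abs_of_nonneg (pow_nonneg hl0 t)]
      _ ≤ ∑ y, |(C.P ^ t) x y - C.π y| * |φ x| := by
          refine (Finset.abs_sum_le_sum_abs _ _).trans (Finset.sum_le_sum fun y _ => ?_)
          rw [abs_mul]
          exact mul_le_mul_of_nonneg_left (hx y) (abs_nonneg _)
      _ = 2 * tv ((C.P ^ t) x) C.π * |φ x| := by rw [← Finset.sum_mul, tv]; ring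
      _ ≤ _ := mul_le_mul_of_nonneg_right (by linarith [tv_le_d (C := C) t x]) hx0.le
  exact le_of_mul_le_mul_right key hx0

/-- Lower bound of the mixing time by the relaxation time. -/
lemma trel_sub_one_mul_log_le (h : C.IsLazyTreeChain G) {ε : ℝ} (hε : 0 < ε) :
    (C.trel - 1) * Real.log (1 / (2 * ε)) ≤ C.tmix ε := by
  have hl0 : 0 ≤ C.lambda₂ := lambda₂_nonneg h.isOn h.isTree.connected h.isLazy h.isReversible
    h.two_le_card
  have hl1 := lambda₂_lt_one h.isOn h.isTree.connected h.isReversible h.two_le_card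
  have hp := (h.lambda₂_pow_le (C.tmix ε)).trans
    (mul_le_mul_of_nonneg_left (h.d_tmix_le hε) (by norm_num))
  set t := C.tmix ε
  rcases hl0.eq_or_lt with h0 | h0
  -- When `lambda₂` is 0 its logarithm is of no use, but `trel - 1` vanishes.
  · rw [trel, ← h0]; simp
  · have h1 := Real.log_le_log (by positivity) hp
    rw [Real.log_pow] at h1
    have h2 := Real.one_sub_inv_le_log_of_pos h0
    have h3 : Real.log (1 / (2 * ε)) ≤ t * (C.lambda₂⁻¹ - 1) := by
      rw [one_div, Real.log_inv]
      have := mul_le_mul_of_nonneg_left h2 (Nat.cast_nonneg (α := ℝ) t)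
      linarith
    have h4 : C.trel - 1 = C.lambda₂ / (1 - C.lambda₂) := by
      have : 1 - C.lambda₂ ≠ 0 := by linarith
      rw [trel]; field_simp; ring
    have h5 : (C.trel - 1) * (C.lambda₂⁻¹ - 1) = 1 := by
      rw [h4]
      have : 1 - C.lambda₂ ≠ 0 := by linarith
      field_simp
    calc (C.trel - 1) * Real.log (1 / (2 * ε))
        ≤ (C.trel - 1) * (t * (C.lambda₂⁻¹ - 1)) :=
          mul_le_mul_of_nonneg_left h3 (by linarith [h.one_le_trel])
      _ = t := by linear_combination (t : ℝ) * h5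

/-- The mixing time of a lazy chain cannot jump from near `1` to near `0` in one step. -/
lemma tmix_lt_tmix (h : C.IsLazyTreeChain G) (h0 : 0 < C.tmix (1 - 1 / 8)) :
    C.tmix (1 - 1 / 8) < C.tmix (1 / 8) := by
  obtain ⟨k, hk⟩ := Nat.exists_eq_succ_of_ne_zero h0.ne'
  have h1 := lt_d_of_lt_tmix (hk ▸ Nat.lt_succ_self k)
  -- One step before the mixing time, `d` exceeds 7/8; after the step it is still at least 7/16 -
  -- 1/8 = 5/16 > 1/8.
  have h2 := le_d_succ h.isLazy h1.le
  by_contra! hle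
  have h3 := (d_antitone (C := C) hle).trans (h.d_tmix_le (by norm_num))
  rw [hk, Nat.succ_eq_add_one] at h3
  linarith

end IsLazyTreeChain

end MarkovChain

/-! ### Sequences of chains: cutoff, product condition, window. -/

section Sequences

open MarkovChain

variable {V : ℕ → Type*} [∀ n, Fintype (V n)] [∀ n, DecidableEq (V n)]
  {G : ∀ n, SimpleGraph (V n)} {C : ∀ n, MarkovChain (V n)}

/-- Cutoff gives `tmix ε` < 2 `tmix (1 - ε)` ≤ 2 `tmix (1/4)` eventually, while `tmix ε` is at least
(`trel` - 1) log(1/(2ε)). A small ε makes `trel - 1` negligible, and the remaining 1 is negligible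
because `tmix` tends to infinity. -/
lemma HasCutoff.productCondition (h : ∀ n, (C n).IsLazyTreeChain (G n)) (hC : HasCutoff C) :
    ProductCondition C := by
  -- `tmix (1/8)` exceeds `tmix (7/8)` by at least 1, so a ratio below 1 + c forces c · `tmix (7/8)`
  -- to exceed 1.
  have hone : ∀ c : ℝ, 0 < c → ∀ᶠ n in atTop, 1 ≤ c * ((C n).tmix (1 / 4) : ℝ) := by
    intro c hc
    have h1 := hC (1 / 8) (by norm_num) (by norm_num)
    filter_upwards [h1.eventually_lt_const (show (1 : ℝ) < 1 + c by linarith),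
      h1.eventually_const_lt (show (0 : ℝ) < 1 by norm_num)] with n hn hn0
    have hk0 : 0 < (C n).tmix (1 - 1 / 8) := by
      by_contra! hk
      rw [Nat.le_zero.1 hk] at hn0
      simp at hn0
    have h2 := (h n).tmix_lt_tmix hk0
    have h3 := (h n).tmix_anti (ε := 1 / 4) (δ := 1 - 1 / 8) (by norm_num) (by norm_num)
    have hk0' : (0 : ℝ) < (C n).tmix (1 - 1 / 8) := by exact_mod_cast hk0
    have h2' : ((C n).tmix (1 - 1 / 8) : ℝ) + 1 ≤ (C n).tmix (1 / 8) := by exact_mod_cast h2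
    have h3' : ((C n).tmix (1 - 1 / 8) : ℝ) ≤ (C n).tmix (1 / 4) := by exact_mod_cast h3
    rw [div_lt_iff₀ hk0'] at hn
    nlinarith
  refine isLittleO_iff.2 fun c hc => ?_
  -- Makes log(1/(2ε)) = 4/c + log 2; half of `c` then pays for `trel - 1` and half for the
  -- remaining 1.
  set ε := Real.exp (-(4 / c)) / 4 with hε
  have hε0 : 0 < ε := by positivity
  have hε4 : ε ≤ 1 / 4 := by
    have : Real.exp (-(4 / c)) ≤ 1 := Real.exp_le_one_iff.2 (by
      have : 0 < 4 / c := by positivity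
      linarith)
    linarith
  have hlog : 4 / c ≤ Real.log (1 / (2 * ε)) := by
    rw [one_div, Real.log_inv, le_neg, Real.log_le_iff_le_exp (by positivity)]
    have := Real.exp_pos (-(4 / c))
    linarith
  have h1 := hC ε hε0 (by linarith)
  filter_upwards [hone (c / 2) (by linarith), h1.eventually_lt_const one_lt_two,
    h1.eventually_const_lt (show (0 : ℝ) < 1 by norm_num)] with n hn1 hn2 hn0
  have hR := (h n).one_le_trel
  rw [Real.norm_of_nonneg (by linarith), Real.norm_of_nonneg (Nat.cast_nonneg _)]
  have hk0 : 0 < ((C n).tmix (1 - ε) : ℝ) := by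
    refine (Nat.cast_nonneg _).lt_of_ne fun hk => ?_
    rw [← hk] at hn0
    simp at hn0
  rw [div_lt_iff₀ hk0] at hn2
  have h2 := (h n).tmix_anti (ε := 1 / 4) (δ := 1 - ε) (by norm_num) (by linarith)
  have h2' : ((C n).tmix (1 - ε) : ℝ) ≤ (C n).tmix (1 / 4) := by exact_mod_cast h2
  have h3 := (h n).trel_sub_one_mul_log_le hε0
  have h4 := (mul_le_mul_of_nonneg_left hlog (by linarith : 0 ≤ (C n).trel - 1)).trans h3
  have h5 : ((C n).trel - 1) * 4 ≤ 2 * (C n).tmix (1 / 4) * c := by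
    rw [← mul_div_assoc, div_le_iff₀ hc] at h4
    nlinarith
  linarith

/-- Both `ε` and 1/4 lie in [δ, 1 - δ], so the two times lie between `tmix (1 - δ)` and `tmix δ`.
Relative to `tmix (1/4)`, this interval has length of order √(`trel` / `tmix (1/4)`), which tends to
0. -/
lemma tendsto_tmix_div (h : ∀ n, (C n).IsLazyTreeChain (G n)) (hC : ProductCondition C)
    {ε : ℝ} (h0 : 0 < ε) (h1 : ε < 1) :
    Tendsto (fun n => ((C n).tmix ε : ℝ) / ((C n).tmix (1 / 4) : ℝ)) atTop (𝓝 1) := by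
  set δ := min (min ε (1 - ε)) (1 / 4) with hδ
  have hδ0 : 0 < δ := lt_min (lt_min h0 (by linarith)) (by norm_num)
  have hδ4 : δ ≤ 1 / 4 := min_le_right _ _
  have hδε : δ ≤ ε := (min_le_left _ _).trans (min_le_left _ _)
  have hδε' : δ ≤ 1 - ε := (min_le_left _ _).trans (min_le_right _ _)
  have hpos : ∀ᶠ n in atTop, 0 < ((C n).tmix (1 / 4) : ℝ) := by
    filter_upwards [isLittleO_iff.1 hC one_pos] with n hn
    rw [Real.norm_of_nonneg (by linarith [(h n).one_le_trel]),
      Real.norm_of_nonneg (Nat.cast_nonneg _)] at hn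
    linarith [(h n).one_le_trel]
  have hlim : Tendsto (fun n => 35 * √(δ⁻¹ * ((C n).trel / ((C n).tmix (1 / 4) : ℝ)))) atTop
      (𝓝 0) := by
    have h2 := ((hC.tendsto_div_nhds_zero.const_mul δ⁻¹).sqrt).const_mul 35
    simpa using h2
  have hbd : ∀ᶠ n in atTop, ((C n).tmix δ : ℝ) / ((C n).tmix (1 / 4) : ℝ) -
      ((C n).tmix (1 - δ) : ℝ) / ((C n).tmix (1 / 4) : ℝ) ≤
      35 * √(δ⁻¹ * ((C n).trel / ((C n).tmix (1 / 4) : ℝ))) := by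
    filter_upwards [hpos] with n hn
    rw [← sub_div, div_le_iff₀ hn]
    refine ((h n).tmix_sub_le hδ0 hδ4).trans (le_of_eq ?_)
    rw [mul_assoc, mul_assoc 35]
    congr 1
    set τ := ((C n).tmix (1 / 4) : ℝ)
    conv_rhs => rw [← Real.sqrt_sq hn.le, ← Real.sqrt_mul' _ (sq_nonneg _)]
    rw [Real.sqrt_sq hn.le]
    congr 1
    field_simp
  have hcmp : ∀ n, ∀ {a b : ℝ}, 0 < a → a ≤ b →
      ((C n).tmix b : ℝ) / ((C n).tmix (1 / 4) : ℝ) ≤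
      ((C n).tmix a : ℝ) / ((C n).tmix (1 / 4) : ℝ) := fun n a b ha hab =>
    div_le_div_of_nonneg_right (by exact_mod_cast (h n).tmix_anti ha hab) (Nat.cast_nonneg _)
  refine tendsto_of_tendsto_of_tendsto_of_le_of_le'
    (g := fun n => 1 - 35 * √(δ⁻¹ * ((C n).trel / ((C n).tmix (1 / 4) : ℝ))))
    (h := fun n => 1 + 35 * √(δ⁻¹ * ((C n).trel / ((C n).tmix (1 / 4) : ℝ))))
    (by simpa using hlim.const_sub 1) (by simpa using hlim.const_add 1) ?_ ?_
  · filter_upwards [hbd, hpos] with n hn hp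
    have e := div_self hp.ne'
    have h2 := hcmp n hδ0 hδ4
    have h3 := hcmp n h0 (show ε ≤ 1 - δ by linarith)
    linarith
  · filter_upwards [hbd, hpos] with n hn hp
    have e := div_self hp.ne'
    have h2 := hcmp n (by norm_num : (0 : ℝ) < 1 / 4) (show 1 / 4 ≤ 1 - δ by linarith)
    have h3 := hcmp n hδ0 hδε
    linarith

lemma ProductCondition.hasCutoff (h : ∀ n, (C n).IsLazyTreeChain (G n))
    (hC : ProductCondition C) : HasCutoff C := by
  intro ε h0 h1
  have h2 := (tendsto_tmix_div h hC h0 h1).div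
    (tendsto_tmix_div h hC (show 0 < 1 - ε by linarith) (by linarith)) one_ne_zero
  rw [div_one] at h2
  refine h2.congr' ?_
  filter_upwards [isLittleO_iff.1 hC one_pos] with n hn
  have hR := (h n).one_le_trel
  rw [Real.norm_of_nonneg (by linarith), Real.norm_of_nonneg (Nat.cast_nonneg _)] at hn
  exact div_div_div_cancel_right₀ (by linarith) _ _

lemma ProductCondition.hasCutoffWindow (h : ∀ n, (C n).IsLazyTreeChain (G n))
    (hC : ProductCondition C) :
    HasCutoffWindow C (fun n => √((C n).trel * ((C n).tmix (1 / 4) : ℝ))) := by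
  refine ⟨isLittleO_iff.2 fun c hc => ?_, fun ε h0 h1 => ?_⟩
  · filter_upwards [isLittleO_iff.1 hC (pow_pos hc 2)] with n hn
    have hR := (h n).one_le_trel
    rw [Real.norm_of_nonneg (by linarith), Real.norm_of_nonneg (Nat.cast_nonneg _)] at hn
    rw [Real.norm_of_nonneg (Real.sqrt_nonneg _), Real.norm_of_nonneg (Nat.cast_nonneg _),
      Real.sqrt_le_left (by positivity)]
    have := mul_le_mul_of_nonneg_right hn (Nat.cast_nonneg (α := ℝ) ((C n).tmix (1 / 4)))
    linarith
  · set δ := min (min ε (1 - ε)) (1 / 4) with hδ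
    have hδ0 : 0 < δ := lt_min (lt_min h0 (by linarith)) (by norm_num)
    have hδ4 : δ ≤ 1 / 4 := min_le_right _ _
    have hδε : δ ≤ ε := (min_le_left _ _).trans (min_le_left _ _)
    refine ⟨35 * √δ⁻¹, by positivity, fun n => ?_⟩
    have h2 := (h n).tmix_sub_le hδ0 hδ4
    rw [mul_assoc δ⁻¹, Real.sqrt_mul (by positivity), ← mul_assoc] at h2
    have h3 : ((C n).tmix ε : ℝ) ≤ (C n).tmix δ := by
      exact_mod_cast (h n).tmix_anti hδ0 hδε
    have h4 : ((C n).tmix (1 - δ) : ℝ) ≤ (C n).tmix (1 - ε) := by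
      exact_mod_cast (h n).tmix_anti (by linarith) (by linarith)
    linarith

end Sequences

end

theorem mainTheorem1 :
    (∀ (V : Type u) [Fintype V] [DecidableEq V] (G : SimpleGraph V) (C : MarkovChain V),
      G.IsTree → C.IsOn G → C.IsLazy → C.IsReversible → 3 ≤ Fintype.card V →
      ∀ ε : ℝ, 0 < ε → ε ≤ 1 / 4 →
        (C.tmix ε : ℝ) - (C.tmix (1 - ε) : ℝ) ≤
          35 * Real.sqrt (ε⁻¹ * C.trel * (C.tmix (1 / 4) : ℝ))) ∧
    (∀ (V : ℕ → Type v) [∀ n, Fintype (V n)] [∀ n, DecidableEq (V n)]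
      (G : ∀ n, SimpleGraph (V n)) (C : ∀ n, MarkovChain (V n)),
      (∀ n, (G n).IsTree) → (∀ n, (C n).IsOn (G n)) → (∀ n, (C n).IsLazy) →
      (∀ n, (C n).IsReversible) → (∀ n, 2 ≤ Fintype.card (V n)) →
      (HasCutoff C ↔ ProductCondition C) ∧
      (ProductCondition C →
        HasCutoffWindow C (fun n => Real.sqrt ((C n).trel * ((C n).tmix (1 / 4) : ℝ))))) := by
  refine ⟨fun V _ _ G C hT hon hlazy hrev hcard ε h0 h4 =>
    MarkovChain.IsLazyTreeChain.tmix_sub_le ⟨hT, hon, hlazy, hrev, by omega⟩ h0 h4,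
    fun V _ _ G C hT hon hlazy hrev hcard => ?_⟩
  have h : ∀ n, (C n).IsLazyTreeChain (G n) := fun n =>
    ⟨hT n, hon n, hlazy n, hrev n, hcard n⟩
  exact ⟨⟨HasCutoff.productCondition h, ProductCondition.hasCutoff h⟩,
    ProductCondition.hasCutoffWindow h⟩
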